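/- Let $d\ge 0$ be an integer and equip $\mathbb{R}^d$ with the Euclidean norm $|\cdot|$. For $p\ge 1$ and Borel probability measures $\mu,\nu$ on $\mathbb{R}^d$ let $$W_p(\mu,\nu)=\inf_{\pi}\Bigl(\iint |x-y|^p\,d\pi(x,y)\Bigr)^{1/p}\in[0,\infty],$$ where $\pi$ runs over all probability measures on $\mathbb{R}^d\times\mathbb{R}^d$ with marginals $\mu$ and $\nu$. Let $H(\nu|\mu)=\int \log\frac{d\nu}{d\mu}\,d\nu$ if $\nu\ll\mu$, and $H(\nu|\mu)=+\infty$ otherwise. For $\lambda>0$, a probability measure $\mu$ satisfies $T_p(\lambda)$ if $W_p(\nu,\mu)\le\sqrt{\tfrac{2}{\lambda}H(\nu|\mu)}$ for every probability measure $\nu$ on $\mathbb{R}^d$. For $\alpha>0$ put $E_\alpha(\mu)=\int_{\mathbb{R}^d} e^{\alpha|x|^2}\,d\mu(x)\in[1,\infty]$. **Theorem.** Let $p\in[1,2]$, $\lambda>0$, $d'>d$, $\lambda'<\lambda$ and $0<\alpha<\lambda/2$ be real numbers. There is a function $N_0:\mathbb{R}\to(0,\infty)$, depending only on $d,p,\lambda,d',\lambda',\alpha$,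 with the following property. Let $\mu$ be any Borel probability measure on $\mathbb{R}^d$ satisfying $T_p(\lambda)$. Then $E_\alpha(\mu)<\infty$, and for every $\varepsilon>0$, every integer $N\ge N_0(E_\alpha(\mu))\,\max(\varepsilon^{-(d'+2)},1)$ and all independent random variables $X^1,\dots,X^N$ with law $\mu$, on any probability space, the empirical measure $\widehat\mu^N=\frac1N\sum_{i=1}^N\delta_{X^i}$ satisfies $$\mathbb{P}\bigl[W_p(\mu,\widehat\mu^N)>\varepsilon\bigr]\le \exp\Bigl(-\gamma_p\,\frac{\lambda'}{2}\,N\,\varepsilon^2\Bigr),\qquad \gamma_p=\begin{cases}1&\text{if }1\le p<2,\\ 3-2\sqrt2&\text{if }p=2.\end{cases}$$ -/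

import Mathlib

open MeasureTheory ProbabilityTheory
open scoped ENNReal

noncomputable section

/-- `π` is a coupling of `μ` and `ν`: a measure on the product space with marginals `μ` and `ν`
(it is a probability measure as soon as `μ` is one). -/
def IsCoupling {X : Type*} [MeasurableSpace X] (π : Measure (X × X)) (μ ν : Measure X) : Prop :=
  π.map Prod.fst = μ ∧ π.map Prod.snd = ν

/-- The Wasserstein distance of order `p`, as an extended nonnegative number:
`W_p(μ, ν) = inf_π (∬ d(x, y)^p dπ(x, y))^(1/p)`, over all couplings `π` of `μ` and `ν`. -/
def wasserstein {X : Type*} [PseudoEMetricSpace X] [MeasurableSpace X]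
    (p : ℝ) (μ ν : Measure X) : ℝ≥0∞ :=
  ⨅ (π : Measure (X × X)) (_ : IsCoupling π μ ν), (∫⁻ z, edist z.1 z.2 ^ p ∂π) ^ (1 / p)

/-- The transportation inequality `T_p(lam)`:
`W_p(ν, μ) ≤ √((2 / lam) H(ν | μ))` for every probability measure `ν`, where the relative entropy
`H(ν | μ)` is the Kullback-Leibler divergence, with values in `[0, ∞]`. -/
def TransportIneq {X : Type*} [PseudoEMetricSpace X] [MeasurableSpace X]
    (p lam : ℝ) (μ : Measure X) : Prop :=
  ∀ ν : Measure X, IsProbabilityMeasure ν →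
    wasserstein p ν μ ≤ (ENNReal.ofReal (2 / lam) * InformationTheory.klDiv ν μ) ^ (1 / 2 : ℝ)

/-- The empirical measure `(1 / N) ∑ i, δ_{x i}` of the points `x 0, …, x (N - 1)`. -/
def empiricalMeasure {X : Type*} [MeasurableSpace X] {N : ℕ} (x : Fin N → X) : Measure X :=
  (N : ℝ≥0∞)⁻¹ • ∑ i, Measure.dirac (x i)

/-- The square-exponential moment `∫ exp (α |x|²) dμ(x)`, with values in `[0, ∞]`. -/
def sqExpMoment {E : Type*} [NormedAddCommGroup E] [MeasurableSpace E]
    (α : ℝ) (μ : Measure E) : ℝ≥0∞ :=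
  ∫⁻ x, ENNReal.ofReal (Real.exp (α * ‖x‖ ^ 2)) ∂μ

/-- The constant `γ_p` for `p ∈ [1, 2]`: `1` if `p < 2` and `3 - 2 √2` if `p = 2`. -/
def gammaConst (p : ℝ) : ℝ :=
  open scoped Classical in if p < 2 then 1 else 3 - 2 * √2

end

/-! ### Relative entropy of conditioned measures. -/

section Entropy

open InformationTheory

variable {Ω : Type*} [MeasurableSpace Ω]

/-! Sort the samples `x` lying in a large ball by the number of points they have in each cell of a
finite partition. All members of such a type class `A` have empirical measures with the same cell
masses. Condition the product law `Q` on `A` and average its marginals: the resulting `ν` has these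
cell masses too, so it is within a cell-size error `η` of each of those empirical measures, while
`klDiv ν μ ≤ N⁻¹ log (1 / Q A)` (`klDiv_averageMarginal_cond_le`). If the empirical measure of one
member of `A` is further than `ε` from `μ`, then `W_p(ν, μ) > ε - η`, and `T_p(lam)` forces `Q A ≤
exp (-N (lam / 2) (ε - η)²)` (`measure_typeClass_le`). There are at most `(N + 1) ^ #cells` classes,
so a union bound finishes.

The partition must have few cells although the points are unbounded. `T_p(lam)` yields
square-exponential moments (`TransportIneq.sqExpMoment_lt_top`), so the mean square norm of the
sample exceeds a suitable `S` only with small probability. Boxes of side `h` in the coordinates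
`arsinh (x i)` have diameter of order `h √(d + |x|²)`, which is small in quadratic mean over the
sample, and only about `(log (N S) / h) ^ d` of them are needed for the ball of radius `√(N S)`.
With `h` of order `min 1 ε`, the logarithm of the number of classes is `(min 1 ε)⁻ᵈ` up to
logarithms. The gap `d < d'` absorbs these logarithms against `N ε²`; the gap `lam' < lam` absorbs
`η` and the count. -/

lemma integrable_of_measurable_of_abs_le {μ : Measure Ω} [IsFiniteMeasure μ] {f : Ω → ℝ}
    (hf : Measurable f) {K : ℝ} (hK : ∀ x, |f x| ≤ K) : Integrable f μ :=
  Integrable.of_bound hf.aestronglyMeasurable K (ae_of_all _ hK)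

lemma rnDeriv_le_of_le_smul {μ ν : Measure Ω} [IsFiniteMeasure μ] [IsFiniteMeasure ν]
    {C : ℝ≥0∞} (h : ν ≤ C • μ) : ∀ᵐ x ∂μ, ν.rnDeriv μ x ≤ C := by
  refine ae_le_of_forall_setLIntegral_le_of_sigmaFinite (Measure.measurable_rnDeriv ν μ)
    fun s hs hμs => ?_
  calc ∫⁻ x in s, ν.rnDeriv μ x ∂μ ≤ ν s := Measure.setLIntegral_rnDeriv_le s
    _ ≤ (C • μ) s := h s
    _ = ∫⁻ _ in s, C ∂μ := by simp

/-- A variational bound for the relative entropy of a measure with bounded density. -/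
lemma klDiv_le_of_forall_integral_le {μ ν : Measure Ω} [IsProbabilityMeasure μ]
    [IsProbabilityMeasure ν] {C : ℝ≥0∞} (hC : C ≠ ∞) (hle : ν ≤ C • μ) {b : ℝ}
    (h : ∀ f : Ω → ℝ, Measurable f → (∃ K, ∀ x, |f x| ≤ K) →
      ∫ x, f x ∂ν ≤ Real.log (∫ x, Real.exp (f x) ∂μ) + b) :
    klDiv ν μ ≤ ENNReal.ofReal b := by
  have hac : ν ≪ μ := Measure.absolutelyContinuous_of_le_smul hle
  have hgC : ∀ᵐ x ∂μ, (ν.rnDeriv μ x).toReal ≤ C.toReal := by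
    filter_upwards [rnDeriv_le_of_le_smul hle] with x hx
    exact ENNReal.toReal_mono hC hx
  have hint : Integrable (llr ν μ) ν := by
    rw [← integrable_klFun_rnDeriv_iff hac]
    have hb := (isCompact_Icc (a := (0 : ℝ)) (b := C.toReal)).exists_bound_of_continuousOn
      (f := klFun) continuous_klFun.continuousOn
    obtain ⟨K, hK⟩ := hb
    refine Integrable.of_bound (C := K) (Measurable.aestronglyMeasurable (by fun_prop)) ?_
    filter_upwards [hgC] with x hx
    exact hK _ ⟨ENNReal.toReal_nonneg, hx⟩
  have hkl : (klDiv ν μ).toReal = ∫ x, llr ν μ x ∂ν :=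
    toReal_klDiv_of_measure_eq hac (by simp)
  have key : (klDiv ν μ).toReal ≤ b := by
    rw [hkl]
    refine le_of_forall_pos_le_add fun δ hδ => ?_
    set g : Ω → ℝ := fun x => min (ν.rnDeriv μ x).toReal C.toReal with hg
    have hg0 : ∀ x, 0 ≤ g x := fun x => le_min ENNReal.toReal_nonneg ENNReal.toReal_nonneg
    have hgm : Measurable g := by fun_prop
    have hgeq : g =ᵐ[μ] fun x => (ν.rnDeriv μ x).toReal := by
      filter_upwards [hgC] with x hx using min_eq_left hx
    -- The optimal test function is the log-density; the cap at `C` and the shift `δ` make it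
    -- bounded, at a cost `log (1 + δ) ≤ δ`.
    set f : Ω → ℝ := fun x => Real.log (g x + δ) with hf
    have hfm : Measurable f := by fun_prop
    have hfb : ∃ K, ∀ x, |f x| ≤ K := by
      refine ⟨|Real.log δ| + |Real.log (C.toReal + δ)|, fun x => ?_⟩
      have h1 : Real.log δ ≤ f x := Real.log_le_log hδ (by linarith [hg0 x])
      have h2 : f x ≤ Real.log (C.toReal + δ) :=
        Real.log_le_log (by linarith [hg0 x]) (by linarith [min_le_right (ν.rnDeriv μ x).toReal C.toReal])
      rw [abs_le]
      constructor
      · linarith [neg_abs_le (Real.log δ), abs_nonneg (Real.log (C.toReal + δ))]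
      · linarith [le_abs_self (Real.log (C.toReal + δ)), abs_nonneg (Real.log δ)]
    have hfint : Integrable f ν := by
      obtain ⟨K, hK⟩ := hfb
      exact integrable_of_measurable_of_abs_le hfm hK
    have h1 : ∫ x, llr ν μ x ∂ν ≤ ∫ x, f x ∂ν := by
      refine integral_mono_ae hint hfint ?_
      filter_upwards [hac.ae_le hgeq, Measure.rnDeriv_pos hac, hac.ae_le (Measure.rnDeriv_lt_top ν μ)]
        with x hx hpos hlt
      simp only [llr, hf]
      rw [hx]
      exact Real.log_le_log (ENNReal.toReal_pos hpos.ne' hlt.ne) (by linarith)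
    have h2 : ∫ x, Real.exp (f x) ∂μ = 1 + δ := by
      have : ∀ x, Real.exp (f x) = g x + δ := fun x => Real.exp_log (by linarith [hg0 x])
      simp only [this]
      rw [integral_add ((integrable_congr hgeq).2 Measure.integrable_toReal_rnDeriv)
        (integrable_const _), integral_congr_ae hgeq, Measure.integral_toReal_rnDeriv hac]
      simp
    have h3 := h f hfm hfb
    rw [h2] at h3
    have h4 := Real.log_le_sub_one_of_pos (show 0 < 1 + δ by linarith)
    linarith
  rw [← ENNReal.ofReal_toReal (klDiv_ne_top hac hint)]
  exact ENNReal.ofReal_le_ofReal key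

lemma cond_le_smul {μ : Measure Ω} (A : Set Ω) : μ[|A] ≤ (μ A)⁻¹ • μ := by
  rw [ProbabilityTheory.cond]
  gcongr
  exact Measure.restrict_le_self

/-- Jensen's inequality for `exp` under the conditioned measure, whose density is at most `1 / μ A`.
-/
lemma integral_cond_le_log_integral_exp {μ : Measure Ω} [IsProbabilityMeasure μ] {A : Set Ω}
    (hA : μ A ≠ 0) {F : Ω → ℝ} (hF : Measurable F) (hFb : ∃ K, ∀ x, |F x| ≤ K) :
    ∫ x, F x ∂μ[|A] ≤ Real.log (∫ x, Real.exp (F x) ∂μ) - Real.log (μ.real A) := by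
  have : IsProbabilityMeasure μ[|A] := cond_isProbabilityMeasure hA
  obtain ⟨K, hK⟩ := hFb
  have hexp : ∀ x, |Real.exp (F x)| ≤ Real.exp K := fun x => by
    rw [abs_of_pos (Real.exp_pos _)]
    exact Real.exp_le_exp.2 ((le_abs_self _).trans (hK x))
  have hAr : 0 < μ.real A := ENNReal.toReal_pos hA (measure_ne_top _ _)
  have hi : Integrable (fun x => Real.exp (F x)) μ :=
    integrable_of_measurable_of_abs_le (by fun_prop) hexp
  have h1 : Real.exp (∫ x, F x ∂μ[|A]) ≤ ∫ x, Real.exp (F x) ∂μ[|A] :=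
    convexOn_exp.map_integral_le Real.continuous_exp.continuousOn isClosed_univ
      (ae_of_all _ fun _ => Set.mem_univ _) (integrable_of_measurable_of_abs_le hF hK)
      (integrable_of_measurable_of_abs_le (by fun_prop) hexp)
  have h2 : ∫ x, Real.exp (F x) ∂μ[|A] ≤ (μ.real A)⁻¹ * ∫ x, Real.exp (F x) ∂μ := by
    have := integral_mono_measure (f := fun x => Real.exp (F x)) (cond_le_smul (μ := μ) A)
      (ae_of_all _ fun x => (Real.exp_pos _).le) (hi.smul_measure (by simpa using hA))
    rwa [integral_smul_measure, ENNReal.toReal_inv, smul_eq_mul] at this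
  have hpos : 0 < ∫ x, Real.exp (F x) ∂μ := integral_exp_pos hi
  have h3 := Real.log_le_log (Real.exp_pos _) (h1.trans h2)
  rw [Real.log_exp, Real.log_mul (inv_ne_zero hAr.ne') hpos.ne', Real.log_inv] at h3
  linarith

lemma klDiv_cond_le {μ : Measure Ω} [IsProbabilityMeasure μ] {A : Set Ω} (hA : μ A ≠ 0) :
    klDiv μ[|A] μ ≤ ENNReal.ofReal (-Real.log (μ.real A)) := by
  have : IsProbabilityMeasure μ[|A] := cond_isProbabilityMeasure hA
  refine klDiv_le_of_forall_integral_le (ENNReal.inv_ne_top.2 hA) (cond_le_smul A)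
    fun f hf hfb => ?_
  exact integral_cond_le_log_integral_exp hA hf hfb

end Entropy

/-! ### Average marginal of a conditioned product measure. -/

section AverageMarginal

open InformationTheory

variable {X : Type*} [MeasurableSpace X] {N : ℕ}

/-- The average of the `N` marginals of a measure on `Fin N → X`. -/
noncomputable def averageMarginal (R : Measure (Fin N → X)) : Measure X :=
  (N : ℝ≥0∞)⁻¹ • ∑ i, R.map fun x => x i

lemma averageMarginal_apply (R : Measure (Fin N → X)) {s : Set X} (hs : MeasurableSet s) :
    averageMarginal R s = (N : ℝ≥0∞)⁻¹ * ∑ i, R {x | x i ∈ s} := by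
  simp only [averageMarginal, Measure.smul_apply, Measure.finsetSum_apply, smul_eq_mul]
  congr 1
  exact Finset.sum_congr rfl fun i _ => Measure.map_apply (measurable_pi_apply i) hs

lemma isProbabilityMeasure_averageMarginal (hN : N ≠ 0) (R : Measure (Fin N → X))
    [IsProbabilityMeasure R] : IsProbabilityMeasure (averageMarginal R) := by
  constructor
  rw [averageMarginal_apply _ MeasurableSet.univ]
  simp only [Set.mem_univ, Set.ofPred_true, measure_univ, Finset.sum_const, Finset.card_univ,
    Fintype.card_fin, nsmul_eq_mul, mul_one]
  exact ENNReal.inv_mul_cancel (by exact_mod_cast hN) (ENNReal.natCast_ne_top N)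

lemma integral_averageMarginal (ρ : Measure (Fin N → X)) [IsProbabilityMeasure ρ] {f : X → ℝ}
    (hf : Measurable f) {K : ℝ} (hK : ∀ x, |f x| ≤ K) :
    ∫ x, f x ∂(averageMarginal ρ) = (N : ℝ)⁻¹ * ∫ x, (∑ i, f (x i)) ∂ρ := by
  rw [averageMarginal, integral_smul_measure, integral_finsetSum_measure,
    integral_finsetSum]
  · simp only [ENNReal.toReal_inv, ENNReal.toReal_natCast, smul_eq_mul]
    congr 1
    refine Finset.sum_congr rfl fun i _ => ?_
    exact integral_map (measurable_pi_apply i).aemeasurable hf.aestronglyMeasurable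
  · intro i _
    exact integrable_of_measurable_of_abs_le (hf.comp (measurable_pi_apply i)) fun x => hK _
  · intro i _
    have : IsProbabilityMeasure (ρ.map fun x => x i) :=
      Measure.isProbabilityMeasure_map (measurable_pi_apply i).aemeasurable
    exact integrable_of_measurable_of_abs_le hf hK

/-- Supplies the bounded density that the variational bound for the entropy requires. -/
lemma averageMarginal_cond_le {μ : Measure X} [IsProbabilityMeasure μ] (hN : N ≠ 0)
    (A : Set (Fin N → X)) :
    averageMarginal ((Measure.pi fun _ : Fin N => μ)[|A]) ≤
      ((Measure.pi fun _ : Fin N => μ) A)⁻¹ • μ := by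
  refine Measure.le_iff.2 fun s hs => ?_
  rw [averageMarginal_apply _ hs, Measure.smul_apply, smul_eq_mul]
  have h : ∀ i, ((Measure.pi fun _ : Fin N => μ)[|A]) {x | x i ∈ s} ≤
      ((Measure.pi fun _ : Fin N => μ) A)⁻¹ * μ s := fun i => by
    refine (cond_le_smul A _).trans_eq ?_
    rw [Measure.smul_apply, smul_eq_mul]
    congr 1
    exact (measurePreserving_eval (fun _ : Fin N => μ) i).measure_preimage hs.nullMeasurableSet
  calc (N : ℝ≥0∞)⁻¹ * ∑ i, ((Measure.pi fun _ : Fin N => μ)[|A]) {x | x i ∈ s}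
      ≤ (N : ℝ≥0∞)⁻¹ * ∑ _i : Fin N, ((Measure.pi fun _ : Fin N => μ) A)⁻¹ * μ s := by
        gcongr with i _; exact h i
    _ = _ := by
        rw [Finset.sum_const, Finset.card_univ, Fintype.card_fin, nsmul_eq_mul, ← mul_assoc,
          ENNReal.inv_mul_cancel (by exact_mod_cast hN) (ENNReal.natCast_ne_top N), one_mul]

/-- Conditioning a product measure on an event of probability `q` yields marginals whose average
has relative entropy at most `N⁻¹ log q⁻¹`. -/
lemma klDiv_averageMarginal_cond_le {μ : Measure X} [IsProbabilityMeasure μ] (hN : N ≠ 0)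
    {A : Set (Fin N → X)} (hA : (Measure.pi fun _ : Fin N => μ) A ≠ 0) :
    klDiv (averageMarginal ((Measure.pi fun _ : Fin N => μ)[|A])) μ ≤
      ENNReal.ofReal ((N : ℝ)⁻¹ * -Real.log ((Measure.pi fun _ : Fin N => μ).real A)) := by
  set Q := Measure.pi fun _ : Fin N => μ with hQ
  have : IsProbabilityMeasure Q[|A] := cond_isProbabilityMeasure hA
  have := isProbabilityMeasure_averageMarginal hN Q[|A]
  have hN' : (0 : ℝ) < N := by exact_mod_cast Nat.pos_of_ne_zero hN
  refine klDiv_le_of_forall_integral_le (ENNReal.inv_ne_top.2 hA) (averageMarginal_cond_le hN A)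
    fun f hf hfb => ?_
  obtain ⟨K, hK⟩ := hfb
  rw [integral_averageMarginal _ hf hK]
  have hFm : Measurable fun x : Fin N → X => ∑ i, f (x i) :=
    Finset.measurable_sum _ fun i _ => hf.comp (measurable_pi_apply i)
  have h := integral_cond_le_log_integral_exp hA hFm ⟨∑ _i : Fin N, K, fun x =>
    (Finset.abs_sum_le_sum_abs _ _).trans (Finset.sum_le_sum fun i _ => hK _)⟩
  -- Independence turns the exponential moment of the sum into an `N`-th power, which makes the
  -- bound additive in `N`.
  have h2 : ∫ x, Real.exp (∑ i, f (x i)) ∂Q = (∫ x, Real.exp (f x) ∂μ) ^ N := by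
    simp only [Real.exp_sum]
    rw [hQ, integral_fintype_prod_eq_prod (fun _ : Fin N => fun x => Real.exp (f x))]
    simp
  rw [h2, Real.log_pow] at h
  calc (N : ℝ)⁻¹ * ∫ x, (∑ i, f (x i)) ∂Q[|A]
      ≤ (N : ℝ)⁻¹ * (N * Real.log (∫ x, Real.exp (f x) ∂μ) - Real.log (Q.real A)) := by gcongr
    _ = Real.log (∫ x, Real.exp (f x) ∂μ) + (N : ℝ)⁻¹ * -Real.log (Q.real A) := by
        field_simp
        ring

end AverageMarginal

/-! ### Gluing along a finite partition. -/

lemma measure_fiber_eq {X Y ι : Type*} [MeasurableSpace X] [MeasurableSpace Y]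
    [MeasurableSpace ι] [MeasurableSingletonClass ι] {b : Y → ι} {c : X → ι} {π : Measure Y}
    {ρ : Measure X} (hb : Measurable b) (hc : Measurable c) (h : π.map b = ρ.map c) (j : ι) :
    π (b ⁻¹' {j}) = ρ (c ⁻¹' {j}) := by
  rw [← Measure.map_apply hb (measurableSet_singleton j), h,
    Measure.map_apply hc (measurableSet_singleton j)]

lemma IsCoupling.isProbabilityMeasure {X : Type*} [MeasurableSpace X] {π : Measure (X × X)} {μ ν : Measure X}
    [IsProbabilityMeasure μ] (h : IsCoupling π μ ν) : IsProbabilityMeasure π := by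
  constructor
  rw [← measure_univ (μ := μ), ← h.1, Measure.map_apply measurable_fst MeasurableSet.univ,
    Set.preimage_univ]

section Gluing

variable {X Y ι : Type*} [MeasurableSpace X] [MeasurableSpace Y] [Fintype ι]
  [MeasurableSpace ι] [MeasurableSingletonClass ι]

/-- The measure on `Y × X` that pairs a `π`-random point `y` with a `ρ`-random point of the cell
`{z | c z = b y}`. -/
noncomputable def cellGlue (b : Y → ι) (c : X → ι) (π : Measure Y) (ρ : Measure X) :
    Measure (Y × X) :=
  ∑ j, (π.restrict (b ⁻¹' {j})).prod (ρ[|c ⁻¹' {j}])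

variable {b : Y → ι} {c : X → ι} {π : Measure Y} {ρ : Measure X}

lemma sum_restrict_fiber (hb : Measurable b) : ∑ j, π.restrict (b ⁻¹' {j}) = π := by
  refine Measure.ext fun s hs => ?_
  rw [Measure.finsetSum_apply]
  simp only [Measure.restrict_apply hs]
  rw [← measure_biUnion_finset]
  · congr 1
    ext x
    simp
  · intro i _ j _ hij
    refine Set.disjoint_left.2 fun x hx hx' => hij ?_
    exact hx.2.symm.trans hx'.2
  · exact fun j _ => hs.inter (hb (measurableSet_singleton j))

lemma map_fst_cellGlue [IsProbabilityMeasure π] [IsProbabilityMeasure ρ]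
    (hb : Measurable b) (hc : Measurable c) (h : π.map b = ρ.map c) :
    (cellGlue b c π ρ).map Prod.fst = π := by
  conv_rhs => rw [← sum_restrict_fiber (π := π) hb]
  rw [cellGlue, Measure.map_finset_sum measurable_fst.aemeasurable]
  refine Finset.sum_congr rfl fun j _ => ?_
  rw [Measure.map_fst_prod]
  -- On a null cell the conditioned measure is zero, but `π` gives no mass to that cell either.
  by_cases h0 : ρ (c ⁻¹' {j}) = 0
  · rw [Measure.restrict_eq_zero.2 (by rw [measure_fiber_eq hb hc h, h0]), smul_zero]
  · have := cond_isProbabilityMeasure h0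
    rw [measure_univ, one_smul]

lemma map_snd_cellGlue [IsProbabilityMeasure π] [IsProbabilityMeasure ρ]
    (hb : Measurable b) (hc : Measurable c) (h : π.map b = ρ.map c) :
    (cellGlue b c π ρ).map Prod.snd = ρ := by
  conv_rhs => rw [← sum_restrict_fiber (π := ρ) hc]
  rw [cellGlue, Measure.map_finset_sum measurable_snd.aemeasurable]
  refine Finset.sum_congr rfl fun j _ => ?_
  rw [Measure.map_snd_prod, Measure.restrict_apply_univ, measure_fiber_eq hb hc h,
    ProbabilityTheory.cond, smul_smul]
  by_cases h0 : ρ (c ⁻¹' {j}) = 0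
  · rw [Measure.restrict_eq_zero.2 h0, smul_zero]
  · rw [ENNReal.mul_inv_cancel h0 (measure_ne_top _ _), one_smul]

lemma ae_cellGlue_eq [SFinite π] [SFinite ρ] (hb : Measurable b) (hc : Measurable c) :
    ∀ᵐ z ∂(cellGlue b c π ρ), b z.1 = c z.2 := by
  rw [cellGlue, ← Measure.sum_fintype, Measure.ae_sum_iff]
  intro j
  have h1 : ∀ᵐ z ∂((π.restrict (b ⁻¹' {j})).prod (ρ[|c ⁻¹' {j}])), b z.1 = j :=
    Measure.quasiMeasurePreserving_fst.ae
      (ae_restrict_mem (hb (measurableSet_singleton j)))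
  have h2 : ∀ᵐ z ∂((π.restrict (b ⁻¹' {j})).prod (ρ[|c ⁻¹' {j}])), c z.2 = j :=
    Measure.quasiMeasurePreserving_snd.ae
      (ae_cond_mem (hc (measurableSet_singleton j)))
  filter_upwards [h1, h2] with z hz1 hz2 using hz1.trans hz2.symm

end Gluing

/-! ### Wasserstein distance between measures with equal cell masses. -/

section Wasserstein

variable {X ι : Type*} [PseudoEMetricSpace X] [MeasurableSpace X]
  [OpensMeasurableSpace X] [SecondCountableTopology X] [Fintype ι] [MeasurableSpace ι]
  [MeasurableSingletonClass ι]

/-- Given a coupling `(y, y')` of `ν` and `μ`, attach a `ρ`-random point `z` of the cell of `y`.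
Then `(y', z)` couples `μ` and `ρ`, with `y` and `z` at distance at most `w z`, and Minkowski's
inequality applies. Since the cells are finite in number, no disintegration is needed. -/
lemma wasserstein_le_add_of_map_eq {p : ℝ} (hp : 1 ≤ p) {ν μ ρ : Measure X}
    [IsProbabilityMeasure ν] [IsProbabilityMeasure ρ] {c : X → ι} (hc : Measurable c)
    (hmap : ν.map c = ρ.map c) {K : Set X} (hνK : ∀ᵐ y ∂ν, y ∈ K) (hρK : ∀ᵐ z ∂ρ, z ∈ K)
    {w : X → ℝ≥0∞} (hwm : Measurable w)
    (hw : ∀ y ∈ K, ∀ z ∈ K, c y = c z → edist y z ≤ w z) :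
    wasserstein p μ ρ ≤ wasserstein p ν μ + (∫⁻ z, w z ^ p ∂ρ) ^ (1 / p) := by
  have hp0 : 0 ≤ p := zero_le_one.trans hp
  rw [wasserstein, wasserstein, ENNReal.iInf₂_add]
  refine le_iInf₂ fun π hπ => ?_
  have : IsProbabilityMeasure π := hπ.isProbabilityMeasure
  have hb : Measurable fun z : X × X => c z.1 := hc.comp measurable_fst
  have hmap' : π.map (fun z : X × X => c z.1) = ρ.map c := by
    rw [← hmap, ← hπ.1, Measure.map_map hc measurable_fst]
    rfl
  set Θ := cellGlue (fun z : X × X => c z.1) c π ρ with hΘ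
  have hfst : Θ.map Prod.fst = π := map_fst_cellGlue hb hc hmap'
  have hsnd : Θ.map Prod.snd = ρ := map_snd_cellGlue hb hc hmap'
  set g : (X × X) × X → X × X := fun z => (z.1.2, z.2) with hg
  have hgm : Measurable g := by fun_prop
  have hcoup : IsCoupling (Θ.map g) μ ρ := by
    refine ⟨?_, ?_⟩
    · rw [Measure.map_map measurable_fst hgm, ← hπ.2, ← hfst,
        Measure.map_map measurable_snd measurable_fst]
      rfl
    · rw [Measure.map_map measurable_snd hgm]
      exact hsnd
  refine (iInf₂_le (Θ.map g) hcoup).trans ?_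
  have hK1 : ∀ᵐ z ∂Θ, z.1.1 ∈ K := by
    have h1 : ∀ᵐ z ∂π, z.1 ∈ K := by
      rw [← hπ.1] at hνK
      exact ae_of_ae_map measurable_fst.aemeasurable hνK
    rw [← hfst] at h1
    exact ae_of_ae_map measurable_fst.aemeasurable h1
  have hK2 : ∀ᵐ z ∂Θ, z.2 ∈ K := by
    rw [← hsnd] at hρK
    exact ae_of_ae_map measurable_snd.aemeasurable hρK
  calc (∫⁻ z, edist z.1 z.2 ^ p ∂Θ.map g) ^ (1 / p)
      = (∫⁻ z, edist z.1.2 z.2 ^ p ∂Θ) ^ (1 / p) := by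
        rw [lintegral_map (by fun_prop) hgm]
    _ ≤ (∫⁻ z, ((fun z : (X × X) × X => edist z.1.1 z.1.2) +
          fun z : (X × X) × X => w z.2) z ^ p ∂Θ) ^ (1 / p) := by
        refine ENNReal.rpow_le_rpow (lintegral_mono_ae ?_) (by positivity)
        filter_upwards [hK1, hK2, ae_cellGlue_eq hb hc] with z h1 h2 h3
        refine ENNReal.rpow_le_rpow ?_ hp0
        calc edist z.1.2 z.2 ≤ edist z.1.2 z.1.1 + edist z.1.1 z.2 := edist_triangle _ _ _
          _ ≤ edist z.1.1 z.1.2 + w z.2 := by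
            rw [edist_comm z.1.2]
            gcongr
            exact hw _ h1 _ h2 h3
    _ ≤ (∫⁻ z, edist z.1.1 z.1.2 ^ p ∂Θ) ^ (1 / p) + (∫⁻ z, w z.2 ^ p ∂Θ) ^ (1 / p) :=
        ENNReal.lintegral_Lp_add_le (by fun_prop) (by fun_prop) hp
    _ = (∫⁻ z, edist z.1 z.2 ^ p ∂π) ^ (1 / p) + (∫⁻ z, w z ^ p ∂ρ) ^ (1 / p) := by
        congr 2
        · conv_rhs => rw [← hfst]
          rw [lintegral_map (by fun_prop) measurable_fst]
        · conv_rhs => rw [← hsnd]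
          rw [lintegral_map (by fun_prop) measurable_snd]

/-- The power mean inequality for the lower Lebesgue integral. -/
lemma lintegral_rpow_le_of_le_two {Y : Type*} [MeasurableSpace Y] {ρ : Measure Y}
    [IsProbabilityMeasure ρ] {p : ℝ} (hp1 : 1 ≤ p) (hp2 : p ≤ 2) {w : Y → ℝ≥0∞}
    (hw : Measurable w) :
    (∫⁻ z, w z ^ p ∂ρ) ^ (1 / p) ≤ (∫⁻ z, w z ^ 2 ∂ρ) ^ (1 / 2 : ℝ) := by
  have h := eLpNorm'_le_eLpNorm'_of_exponent_le (f := w) (μ := ρ) (p := p) (q := 2)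
    (by linarith) hp2 hw.aestronglyMeasurable
  simpa [eLpNorm'] using h

end Wasserstein

/-! ### From the transport inequality to square-exponential moments. -/

lemma TransportIneq.wasserstein_le {X : Type*} [PseudoEMetricSpace X] [MeasurableSpace X]
    {p lam b : ℝ} (hlam : 0 < lam) {ν μ : Measure X}
    [IsProbabilityMeasure ν] (hT : TransportIneq p lam μ)
    (hb : InformationTheory.klDiv ν μ ≤ ENNReal.ofReal b) :
    wasserstein p ν μ ≤ ENNReal.ofReal (√(2 / lam * b)) := by
  refine (hT ν inferInstance).trans ?_
  rw [Real.sqrt_eq_rpow]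
  by_cases hb0 : 0 ≤ b
  · rw [← ENNReal.ofReal_rpow_of_nonneg (by positivity) (by positivity),
      ENNReal.ofReal_mul (by positivity)]
    gcongr
  · rw [ENNReal.ofReal_of_nonpos (not_le.1 hb0).le, nonpos_iff_eq_zero] at hb
    rw [hb]
    simp

section Moment

variable {E : Type*} [NormedAddCommGroup E] [MeasurableSpace E] [OpensMeasurableSpace E]
  [SecondCountableTopology E]

lemma IsCoupling.lintegral_enorm_le {π : Measure (E × E)} {ν μ : Measure E}
    [IsProbabilityMeasure ν] {p : ℝ} (hp : 1 ≤ p) (h : IsCoupling π ν μ) :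
    ∫⁻ x, ‖x‖ₑ ∂ν ≤ ∫⁻ x, ‖x‖ₑ ∂μ + (∫⁻ z, edist z.1 z.2 ^ p ∂π) ^ (1 / p) ∧
      ∫⁻ x, ‖x‖ₑ ∂μ ≤ ∫⁻ x, ‖x‖ₑ ∂ν + (∫⁻ z, edist z.1 z.2 ^ p ∂π) ^ (1 / p) := by
  have := h.isProbabilityMeasure
  have h1 : ∫⁻ x, ‖x‖ₑ ∂ν = ∫⁻ z, ‖z.1‖ₑ ∂π := by
    rw [← h.1, lintegral_map (by fun_prop) measurable_fst]
  have h2 : ∫⁻ x, ‖x‖ₑ ∂μ = ∫⁻ z, ‖z.2‖ₑ ∂π := by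
    rw [← h.2, lintegral_map (by fun_prop) measurable_snd]
  have h3 : ∫⁻ z, edist z.1 z.2 ∂π ≤ (∫⁻ z, edist z.1 z.2 ^ p ∂π) ^ (1 / p) := by
    have := eLpNorm'_le_eLpNorm'_of_exponent_le (f := fun z : E × E => edist z.1 z.2) (μ := π)
      (p := 1) (q := p) one_pos hp (Measurable.aestronglyMeasurable (by fun_prop))
    simpa [eLpNorm'] using this
  rw [h1, h2]
  refine ⟨?_, ?_⟩
  · refine le_trans ?_ (add_le_add_right h3 _)
    rw [← lintegral_add_left (by fun_prop)]
    refine lintegral_mono fun z => ?_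
    rw [← edist_zero_right, ← edist_zero_right, add_comm]
    exact edist_triangle _ _ _
  · refine le_trans ?_ (add_le_add_right h3 _)
    rw [← lintegral_add_left (by fun_prop)]
    refine lintegral_mono fun z => ?_
    rw [← edist_zero_right, ← edist_zero_right, add_comm, edist_comm z.1 z.2]
    exact edist_triangle _ _ _

lemma lintegral_enorm_le_add_wasserstein {ν μ : Measure E} [IsProbabilityMeasure ν]
    {p : ℝ} (hp : 1 ≤ p) :
    ∫⁻ x, ‖x‖ₑ ∂ν ≤ ∫⁻ x, ‖x‖ₑ ∂μ + wasserstein p ν μ := by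
  rw [wasserstein, ENNReal.add_iInf₂]
  exact le_iInf₂ fun π h => (h.lintegral_enorm_le hp).1

lemma lintegral_enorm_le_add_wasserstein' {ν μ : Measure E} [IsProbabilityMeasure ν]
    {p : ℝ} (hp : 1 ≤ p) :
    ∫⁻ x, ‖x‖ₑ ∂μ ≤ ∫⁻ x, ‖x‖ₑ ∂ν + wasserstein p ν μ := by
  rw [wasserstein, ENNReal.add_iInf₂]
  exact le_iInf₂ fun π h => (h.lintegral_enorm_le hp).2

/-- Conditioning on a ball of positive mass gives a boundedly supported measure of finite entropy,
hence at finite distance from `μ`. -/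
lemma TransportIneq.lintegral_enorm_lt_top {p lam : ℝ} (hp : 1 ≤ p) (hlam : 0 < lam)
    {μ : Measure E} [IsProbabilityMeasure μ] (hT : TransportIneq p lam μ) :
    ∫⁻ x, ‖x‖ₑ ∂μ < ∞ := by
  obtain ⟨n, hn⟩ : ∃ n : ℕ, μ (Metric.ball 0 n) ≠ 0 := by
    by_contra! h
    have h0 := measure_iUnion_null h
    rw [Metric.iUnion_ball_nat] at h0
    simp at h0
  have : IsProbabilityMeasure μ[|Metric.ball 0 n] := cond_isProbabilityMeasure hn
  refine (lintegral_enorm_le_add_wasserstein' (ν := μ[|Metric.ball 0 n]) hp).trans_lt ?_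
  refine ENNReal.add_lt_top.2 ⟨?_, ?_⟩
  · calc ∫⁻ x, ‖x‖ₑ ∂μ[|Metric.ball 0 n] ≤ ∫⁻ _, (n : ℝ≥0∞) ∂μ[|Metric.ball 0 n] := by
          refine lintegral_mono_ae ?_
          filter_upwards [ae_cond_mem (μ := μ) Metric.isOpen_ball.measurableSet] with x hx
          rw [← edist_zero_right, edist_dist, ← ENNReal.ofReal_natCast]
          exact ENNReal.ofReal_le_ofReal (Metric.mem_ball.1 hx).le
      _ < ∞ := by simp
  · exact (hT.wasserstein_le hlam (klDiv_cond_le hn)).trans_lt ENNReal.ofReal_lt_top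

/-- Marton's argument: conditioned on the tail event `A`, the mean norm is at least `r`, yet it
exceeds the mean norm `m` under `μ` by at most `√((2 / lam) log (1 / μ A))`. -/
lemma TransportIneq.measure_norm_ge_le {p lam : ℝ} (hp : 1 ≤ p) (hlam : 0 < lam)
    {μ : Measure E} [IsProbabilityMeasure μ] (hT : TransportIneq p lam μ) {r : ℝ} (hr : 0 ≤ r) :
    μ {x | r ≤ ‖x‖} ≤ ENNReal.ofReal (Real.exp (-(lam / 2) *
      ((r - (∫⁻ x, ‖x‖ₑ ∂μ).toReal) ^ 2 - (∫⁻ x, ‖x‖ₑ ∂μ).toReal ^ 2))) := by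
  set A : Set E := {x | r ≤ ‖x‖} with hA
  have hAm : MeasurableSet A := measurableSet_le measurable_const (by fun_prop)
  set m := (∫⁻ x, ‖x‖ₑ ∂μ).toReal with hm
  have hm0 : 0 ≤ m := ENNReal.toReal_nonneg
  rw [← ENNReal.ofReal_toReal (measure_ne_top μ A)]
  refine ENNReal.ofReal_le_ofReal ?_
  -- The summand `m²` in the exponent makes the bound trivial for `r ≤ m`, so that it holds for all
  -- `r ≥ 0`.
  rcases le_total r m with hrm | hrm
  · calc (μ A).toReal ≤ 1 := measureReal_le_one
      _ ≤ _ := by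
        rw [Real.one_le_exp_iff]
        have : (r - m) ^ 2 ≤ m ^ 2 := by nlinarith
        nlinarith
  by_cases h0 : μ A = 0
  · rw [h0]
    exact (Real.exp_pos _).le
  have : IsProbabilityMeasure μ[|A] := cond_isProbabilityMeasure h0
  have hpos : 0 < μ.real A := ENNReal.toReal_pos h0 (measure_ne_top _ _)
  have hlog : 0 ≤ -Real.log (μ.real A) := by
    have := Real.log_nonpos hpos.le measureReal_le_one
    linarith
  have h1 : ENNReal.ofReal r ≤ ∫⁻ x, ‖x‖ₑ ∂μ[|A] := by
    calc ENNReal.ofReal r = ∫⁻ _, ENNReal.ofReal r ∂μ[|A] := by simp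
      _ ≤ _ := by
        refine lintegral_mono_ae ?_
        filter_upwards [ae_cond_mem (μ := μ) hAm] with x hx
        rw [← ofReal_norm]
        exact ENNReal.ofReal_le_ofReal hx
  have h2 := h1.trans (lintegral_enorm_le_add_wasserstein (μ := μ) hp)
  have h3 := h2.trans (add_le_add_right (hT.wasserstein_le hlam (klDiv_cond_le h0)) _)
  rw [← ENNReal.ofReal_toReal (hT.lintegral_enorm_lt_top hp hlam).ne,
    ← ENNReal.ofReal_add hm0 (Real.sqrt_nonneg _),
    ENNReal.ofReal_le_ofReal_iff (by positivity)] at h3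
  have h4 : (r - m) ^ 2 ≤ 2 / lam * -Real.log (μ.real A) := by
    rw [← Real.sq_sqrt (show 0 ≤ 2 / lam * -Real.log (μ.real A) by positivity)]
    exact pow_le_pow_left₀ (by linarith) (by linarith) 2
  have h5 : Real.log (μ.real A) ≤ -(lam / 2) * (r - m) ^ 2 := by
    have := mul_le_mul_of_nonneg_left h4 (show 0 ≤ lam / 2 by positivity)
    have h6 : lam / 2 * (2 / lam * -Real.log (μ.real A)) = -Real.log (μ.real A) := by
      field_simp
    linarith
  calc (μ A).toReal = Real.exp (Real.log (μ.real A)) := (Real.exp_log hpos).symm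
    _ ≤ _ := Real.exp_le_exp.2 (by nlinarith [sq_nonneg m])

/-- A transportation inequality of constant `lam` implies square-exponential integrability up to
the exponent `lam / 2`. -/
theorem TransportIneq.sqExpMoment_lt_top {p lam α : ℝ} (hp : 1 ≤ p) (hα0 : 0 < α)
    (hα : α < lam / 2) {μ : Measure E} [IsProbabilityMeasure μ] (hT : TransportIneq p lam μ) :
    sqExpMoment α μ < ∞ := by
  have hlam : 0 < lam := by linarith
  set m := (∫⁻ x, ‖x‖ₑ ∂μ).toReal with hm
  have hm0 : 0 ≤ m := ENNReal.toReal_nonneg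
  set κ := lam / 2 - α with hκ
  have hκ0 : 0 < κ := by linarith
  -- The linear coefficient of the exponent plus `1`; completing the square then leaves a summable
  -- factor `exp (-n)`.
  set b := 2 * α + lam * m + 1 with hb
  have hquad : ∀ n : ℝ, α * (n + 1) ^ 2 + -(lam / 2) * ((n - m) ^ 2 - m ^ 2) ≤
      (b ^ 2 / (4 * κ) + α) + -n := by
    intro n
    have h1 : b ^ 2 / (4 * κ) - b * n + κ * n ^ 2 = (b - 2 * κ * n) ^ 2 / (4 * κ) := by
      field_simp
      ring
    have h2 : 0 ≤ (b - 2 * κ * n) ^ 2 / (4 * κ) := by positivity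
    have h3 : α * (n + 1) ^ 2 + -(lam / 2) * ((n - m) ^ 2 - m ^ 2) =
      -κ * n ^ 2 + b * n - n + α := by rw [hκ, hb]; ring
    linarith
  have hpt : ∀ x : E, ENNReal.ofReal (Real.exp (α * ‖x‖ ^ 2)) ≤
      ∑' n : ℕ, Set.indicator {x : E | (n : ℝ) ≤ ‖x‖}
        (fun _ => ENNReal.ofReal (Real.exp (α * ((n : ℝ) + 1) ^ 2))) x := by
    intro x
    refine le_trans ?_ (ENNReal.le_tsum ⌊‖x‖⌋₊)
    have hmem : x ∈ {y : E | (⌊‖x‖⌋₊ : ℝ) ≤ ‖y‖} := Nat.floor_le (norm_nonneg x)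
    rw [Set.indicator_of_mem hmem]
    refine ENNReal.ofReal_le_ofReal (Real.exp_le_exp.2 ?_)
    have := (Nat.lt_floor_add_one ‖x‖).le
    gcongr
  have hms : ∀ n : ℕ, MeasurableSet {x : E | (n : ℝ) ≤ ‖x‖} := fun n =>
    measurableSet_le measurable_const (by fun_prop)
  calc sqExpMoment α μ ≤ ∫⁻ x, ∑' n : ℕ, Set.indicator {x : E | (n : ℝ) ≤ ‖x‖}
        (fun _ => ENNReal.ofReal (Real.exp (α * ((n : ℝ) + 1) ^ 2))) x ∂μ := lintegral_mono hpt
    _ = ∑' n : ℕ, ENNReal.ofReal (Real.exp (α * ((n : ℝ) + 1) ^ 2)) *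
          μ {x : E | (n : ℝ) ≤ ‖x‖} := by
        rw [lintegral_tsum fun n => (measurable_const.indicator (hms n)).aemeasurable]
        exact tsum_congr fun n => lintegral_indicator_const (hms n) _
    _ ≤ ∑' n : ℕ, ENNReal.ofReal (Real.exp (b ^ 2 / (4 * κ) + α) * Real.exp (-(n : ℝ))) := by
        refine ENNReal.tsum_le_tsum fun n => ?_
        refine (mul_le_mul_right (hT.measure_norm_ge_le hp hlam n.cast_nonneg) _).trans ?_
        rw [← ENNReal.ofReal_mul (Real.exp_pos _).le, ← Real.exp_add, ← Real.exp_add]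
        exact ENNReal.ofReal_le_ofReal (Real.exp_le_exp.2 (hquad n))
    _ < ∞ := (Real.summable_exp_neg_nat.mul_left _).tsum_ofReal_lt_top

end Moment

/-! ### Partition into boxes in arsinh coordinates. -/

section Cells

/-- The derivative of `arsinh` is `1 / √(1 + y²)`, so a step `h` in its scale has length about `h
√(1 + y²)`. The factor `2` comes from `exp |u| - 1 ≤ 2 |u|` for `|u| ≤ 1`. -/
lemma Real.abs_sub_le_of_abs_arsinh_sub_le {x y h : ℝ} (hh1 : h ≤ 1)
    (hxy : |Real.arsinh x - Real.arsinh y| ≤ h) : |x - y| ≤ 2 * h * √(1 + y ^ 2) := by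
  set b := Real.arsinh y with hb
  set u := Real.arsinh x - b with hu
  have hx : x = Real.sinh (b + u) := by rw [hu, add_sub_cancel, Real.sinh_arsinh]
  have hy : y = Real.sinh b := (Real.sinh_arsinh y).symm
  have hc : √(1 + y ^ 2) = Real.cosh b := (Real.cosh_arsinh y).symm
  have hcpos := Real.cosh_pos b
  have hs : |Real.sinh b| ≤ Real.cosh b := by
    rw [abs_le]
    constructor <;> linarith [Real.exp_pos b, Real.exp_pos (-b), Real.cosh_add_sinh b,
      Real.cosh_sub_sinh b]
  have hu1 : |u| ≤ 1 := hxy.trans hh1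
  have hexp : Real.cosh u - 1 + |Real.sinh u| ≤ 2 * |u| := by
    have h1 := Real.abs_exp_sub_one_le (x := |u|) (by rwa [abs_abs])
    rw [abs_abs] at h1
    have h2 : Real.exp |u| = Real.cosh u + |Real.sinh u| := by
      rw [← Real.cosh_abs, Real.abs_sinh, Real.cosh_add_sinh]
    linarith [le_abs_self (Real.exp |u| - 1)]
  rw [hc, hx, hy, Real.sinh_add]
  calc |Real.sinh b * Real.cosh u + Real.cosh b * Real.sinh u - Real.sinh b|
      = |Real.sinh b * (Real.cosh u - 1) + Real.cosh b * Real.sinh u| := by ring_nf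
    _ ≤ |Real.sinh b| * (Real.cosh u - 1) + Real.cosh b * |Real.sinh u| := by
        refine (abs_add_le _ _).trans ?_
        rw [abs_mul, abs_mul, abs_of_pos hcpos,
          abs_of_nonneg (show 0 ≤ Real.cosh u - 1 by linarith [Real.one_le_cosh u])]
    _ ≤ Real.cosh b * (Real.cosh u - 1) + Real.cosh b * |Real.sinh u| := by
        have := Real.one_le_cosh u
        gcongr
    _ = (Real.cosh u - 1 + |Real.sinh u|) * Real.cosh b := by ring
    _ ≤ 2 * h * Real.cosh b := by
        gcongr
        linarith

variable {d : ℕ}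

/-- The index of the cell containing `x` in the partition of `ℝ^d` into boxes that have side `h`
in the coordinates `arsinh (x i)`; indices are clamped to `[-L, L]`. -/
noncomputable def arsinhCell (h : ℝ) (L : ℕ) (x : EuclideanSpace ℝ (Fin d)) :
    Fin d → Set.Icc (-(L : ℤ)) L :=
  fun i => Set.projIcc (-(L : ℤ)) L (by lia) ⌊Real.arsinh (x i) / h⌋

lemma measurable_arsinhCell (h : ℝ) (L : ℕ) :
    Measurable (arsinhCell h L : EuclideanSpace ℝ (Fin d) → _) := by
  refine measurable_pi_lambda _ fun i => ?_
  refine (Measurable.of_discrete (f := Set.projIcc (-(L : ℤ)) L (by lia))).comp ?_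
  refine Int.measurable_floor.comp ?_
  have : Measurable Real.arsinh := Real.continuous_arsinh.measurable
  fun_prop

lemma norm_sub_sq_le_of_arsinhCell_eq {h ρ : ℝ} (hh0 : 0 < h) (hh1 : h ≤ 1) {L : ℕ}
    (hL : Real.arsinh ρ ≤ h * L) {x y : EuclideanSpace ℝ (Fin d)} (hx : ‖x‖ ≤ ρ) (hy : ‖y‖ ≤ ρ)
    (hxy : arsinhCell h L x = arsinhCell h L y) :
    ‖x - y‖ ^ 2 ≤ 4 * h ^ 2 * (d + ‖y‖ ^ 2) := by
  -- Clamping has no effect inside the ball of radius `ρ`, so equal indices there mean equal floors.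
  have hfloor : ∀ z : EuclideanSpace ℝ (Fin d), ‖z‖ ≤ ρ → ∀ i,
      ⌊Real.arsinh (z i) / h⌋ ∈ Set.Icc (-(L : ℤ)) L := by
    intro z hz i
    have h1 : |z i| ≤ ρ := (PiLp.norm_apply_le z i).trans hz
    have h2 : Real.arsinh (z i) ≤ h * L :=
      (Real.arsinh_le_arsinh.2 ((le_abs_self _).trans h1)).trans hL
    have h3 : -(h * L) ≤ Real.arsinh (z i) := by
      have := Real.arsinh_le_arsinh.2 ((neg_le_abs (z i)).trans h1)
      rw [Real.arsinh_neg] at this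
      linarith
    refine ⟨?_, ?_⟩
    · rw [Int.le_floor, le_div_iff₀ hh0]
      push_cast
      linarith
    · have : ((⌊Real.arsinh (z i) / h⌋ : ℤ) : ℝ) ≤ (L : ℤ) := by
        refine (Int.floor_le _).trans ?_
        rw [div_le_iff₀ hh0]
        push_cast
        linarith
      exact_mod_cast this
  have hcoord : ∀ i, (x i - y i) ^ 2 ≤ 4 * h ^ 2 * (1 + y i ^ 2) := by
    intro i
    have h1 : ⌊Real.arsinh (x i) / h⌋ = ⌊Real.arsinh (y i) / h⌋ := by
      have := congrArg Subtype.val (congrFun hxy i)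
      rwa [arsinhCell, arsinhCell, Set.projIcc_of_mem _ (hfloor x hx i),
        Set.projIcc_of_mem _ (hfloor y hy i)] at this
    have h2 := (Int.abs_sub_lt_one_of_floor_eq_floor h1).le
    rw [← sub_div, abs_div, abs_of_pos hh0, div_le_one hh0] at h2
    have h3 := Real.abs_sub_le_of_abs_arsinh_sub_le hh1 h2
    calc (x i - y i) ^ 2 = |x i - y i| ^ 2 := (sq_abs _).symm
      _ ≤ (2 * h * √(1 + y i ^ 2)) ^ 2 := by gcongr
      _ = 4 * h ^ 2 * (1 + y i ^ 2) := by
        rw [mul_pow, Real.sq_sqrt (by positivity)]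
        ring
  rw [EuclideanSpace.real_norm_sq_eq, EuclideanSpace.real_norm_sq_eq]
  calc ∑ i, (x - y) i ^ 2 ≤ ∑ i, 4 * h ^ 2 * (1 + y i ^ 2) :=
        Finset.sum_le_sum fun i _ => hcoord i
    _ = 4 * h ^ 2 * (d + ∑ i, y i ^ 2) := by
        rw [← Finset.mul_sum, Finset.sum_add_distrib]
        simp

lemma card_arsinhCell (L : ℕ) :
    Fintype.card (Fin d → Set.Icc (-(L : ℤ)) L) = (2 * L + 1) ^ d := by
  rw [Fintype.card_fun, Fintype.card_fin, ← Set.toFinset_card, Set.toFinset_Icc, Int.card_Icc]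
  congr 1
  lia

end Cells

/-! ### Occupation numbers and type classes. -/

open scoped Classical in
lemma sum_indicator_cell {X ι : Type*} {N : ℕ} (c : X → ι) (x : Fin N → X) (j : ι) :
    ∑ i, {y : Fin N → X | c (y i) = j}.indicator (1 : (Fin N → X) → ℝ≥0∞) x =
      ((Finset.univ.filter fun i => c (x i) = j).card : ℝ≥0∞) := by
  simp [Set.indicator_apply, Finset.sum_boole]

section Types

variable {X ι : Type*} [MeasurableSpace X] [MeasurableSpace ι]
  [MeasurableSingletonClass ι] {N : ℕ}

lemma isProbabilityMeasure_empiricalMeasure (hN : N ≠ 0) (x : Fin N → X) :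
    IsProbabilityMeasure (empiricalMeasure x) := by
  constructor
  simp only [empiricalMeasure, Measure.smul_apply, Measure.finsetSum_apply, measure_univ,
    Finset.sum_const, Finset.card_univ, Fintype.card_fin, nsmul_eq_mul, mul_one, smul_eq_mul]
  exact ENNReal.inv_mul_cancel (by exact_mod_cast hN) (ENNReal.natCast_ne_top N)

lemma lintegral_empiricalMeasure (x : Fin N → X) {f : X → ℝ≥0∞} (hf : Measurable f) :
    ∫⁻ z, f z ∂(empiricalMeasure x) = (N : ℝ≥0∞)⁻¹ * ∑ i, f (x i) := by
  rw [empiricalMeasure, lintegral_smul_measure, lintegral_finsetSum_measure, smul_eq_mul]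
  simp only [lintegral_dirac' _ hf]

lemma ae_empiricalMeasure {x : Fin N → X} {K : Set X} (hK : MeasurableSet K)
    (h : ∀ i, x i ∈ K) : ∀ᵐ z ∂(empiricalMeasure x), z ∈ K := by
  refine Measure.ae_smul_measure ?_ _
  rw [← Measure.sum_fintype, Measure.ae_sum_iff]
  exact fun i => (ae_dirac_iff hK).2 (h i)

open scoped Classical in
/-- The configurations of `N` points of `K` that have `k j` points in the cell `j`, for all `j`. -/
def typeClass (c : X → ι) (K : Set X) (k : ι → Fin (N + 1)) : Set (Fin N → X) :=
  {x | (∀ i, x i ∈ K) ∧ ∀ j, (Finset.univ.filter fun i => c (x i) = j).card = k j}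

lemma measurableSet_typeClass [Countable ι] {c : X → ι} (hc : Measurable c) {K : Set X}
    (hK : MeasurableSet K) (k : ι → Fin (N + 1)) : MeasurableSet (typeClass c K k) := by
  classical
  have h1 : MeasurableSet {x : Fin N → X | ∀ i, x i ∈ K} := by
    rw [Set.ofPred_forall]
    exact MeasurableSet.iInter fun i => measurable_pi_apply i hK
  have h2 : ∀ j, MeasurableSet {x : Fin N → X |
      (Finset.univ.filter fun i => c (x i) = j).card = (k j : ℕ)} := by
    intro j
    have hm : Measurable fun x : Fin N → X =>
        ∑ i, {y : Fin N → X | c (y i) = j}.indicator (1 : (Fin N → X) → ℝ≥0∞) x := by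
      refine Finset.measurable_sum _ fun i _ => measurable_one.indicator ?_
      exact (hc.comp (measurable_pi_apply i)) (measurableSet_singleton j)
    have := hm (measurableSet_singleton ((k j : ℕ) : ℝ≥0∞))
    convert this using 1
    ext x
    simp only [Set.mem_preimage, Set.mem_singleton_iff, sum_indicator_cell, Set.mem_ofPred_eq,
      Nat.cast_inj]
  have h3 : typeClass c K k = {x : Fin N → X | ∀ i, x i ∈ K} ∩ ⋂ j, {x : Fin N → X |
      (Finset.univ.filter fun i => c (x i) = j).card = (k j : ℕ)} := by
    ext x
    simp [typeClass]
  rw [h3]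
  exact h1.inter (MeasurableSet.iInter h2)

/-- The mass of a cell is the mean proportion of points in it, and this proportion is constant on
the type class. -/
lemma averageMarginal_cell {c : X → ι} (hc : Measurable c) {K : Set X}
    {k : ι → Fin (N + 1)} {ρ : Measure (Fin N → X)} [IsProbabilityMeasure ρ]
    (hρ : ∀ᵐ x ∂ρ, x ∈ typeClass c K k) (j : ι) :
    averageMarginal ρ (c ⁻¹' {j}) = (N : ℝ≥0∞)⁻¹ * (k j : ℕ) := by
  classical
  have hm : ∀ i, MeasurableSet {y : Fin N → X | c (y i) = j} := fun i =>
    (hc.comp (measurable_pi_apply i)) (measurableSet_singleton j)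
  rw [averageMarginal_apply _ (hc (measurableSet_singleton j))]
  congr 1
  calc ∑ i, ρ {x | x i ∈ c ⁻¹' {j}}
      = ∑ i, ∫⁻ x, {y : Fin N → X | c (y i) = j}.indicator (1 : (Fin N → X) → ℝ≥0∞) x ∂ρ :=
        Finset.sum_congr rfl fun i _ => (lintegral_indicator_one (hm i)).symm
    _ = ∫⁻ x, ∑ i, {y : Fin N → X | c (y i) = j}.indicator (1 : (Fin N → X) → ℝ≥0∞) x ∂ρ :=
        (lintegral_finsetSum _ fun i _ => measurable_one.indicator (hm i)).symm
    _ = ∫⁻ _, ((k j : ℕ) : ℝ≥0∞) ∂ρ := by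
        refine lintegral_congr_ae ?_
        filter_upwards [hρ] with x hx
        rw [sum_indicator_cell, hx.2 j]
    _ = ((k j : ℕ) : ℝ≥0∞) := by simp

lemma empiricalMeasure_cell {c : X → ι} (hc : Measurable c) {K : Set X}
    {k : ι → Fin (N + 1)} {x : Fin N → X} (hx : x ∈ typeClass c K k) (j : ι) :
    empiricalMeasure x (c ⁻¹' {j}) = (N : ℝ≥0∞)⁻¹ * (k j : ℕ) := by
  classical
  simp only [empiricalMeasure, Measure.smul_apply, Measure.finsetSum_apply, smul_eq_mul]
  congr 1
  rw [← hx.2 j, ← sum_indicator_cell]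
  exact Finset.sum_congr rfl fun i _ => Measure.dirac_apply' _ (hc (measurableSet_singleton j))

lemma map_averageMarginal_eq_map_empiricalMeasure [Countable ι] {c : X → ι} (hc : Measurable c) {K : Set X}
    {k : ι → Fin (N + 1)} {ρ : Measure (Fin N → X)} [IsProbabilityMeasure ρ]
    (hρ : ∀ᵐ x ∂ρ, x ∈ typeClass c K k) {x : Fin N → X} (hx : x ∈ typeClass c K k) :
    (averageMarginal ρ).map c = (empiricalMeasure x).map c := by
  refine Measure.ext_of_singleton fun j => ?_
  rw [Measure.map_apply hc (measurableSet_singleton j),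
    Measure.map_apply hc (measurableSet_singleton j), averageMarginal_cell hc hρ,
    empiricalMeasure_cell hc hx]

lemma ae_averageMarginal_mem {ρ : Measure (Fin N → X)} {K : Set X}
    (hK : MeasurableSet K) (h : ∀ᵐ x ∂ρ, ∀ i, x i ∈ K) : ∀ᵐ z ∂(averageMarginal ρ), z ∈ K := by
  refine Measure.ae_smul_measure ?_ _
  rw [← Measure.sum_fintype, Measure.ae_sum_iff]
  intro i
  have hK' : MeasurableSet {z | z ∈ K} := hK
  refine (ae_map_iff (measurable_pi_apply i).aemeasurable hK').2 ?_
  filter_upwards [h] with x hx using hx i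

end Types

/-! ### Deviation bound by counting type classes. -/

section Deviation

variable {X ι : Type*} [PseudoEMetricSpace X] [MeasurableSpace X]
  [OpensMeasurableSpace X] [SecondCountableTopology X] [Fintype ι] [MeasurableSpace ι]
  [MeasurableSingletonClass ι] {N : ℕ}

/-- A single bad configuration `x` bounds the probability of its whole class: the averaged
conditional law shares the cell masses of `x`, so it is far from `μ` and must have large entropy. -/
lemma measure_typeClass_le {p lam ε η : ℝ} (hp : 1 ≤ p) (hlam : 0 < lam) (hη : 0 ≤ η)
    (hηε : η ≤ ε) {μ : Measure X} [IsProbabilityMeasure μ] (hT : TransportIneq p lam μ)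
    (hN : N ≠ 0) {c : X → ι} (hc : Measurable c) {K : Set X} (hK : MeasurableSet K)
    {w : X → ℝ≥0∞} (hwm : Measurable w)
    (hw : ∀ y ∈ K, ∀ z ∈ K, c y = c z → edist y z ≤ w z) {k : ι → Fin (N + 1)}
    {x : Fin N → X} (hx : x ∈ typeClass c K k)
    (hxη : (∫⁻ z, w z ^ p ∂(empiricalMeasure x)) ^ (1 / p) ≤ ENNReal.ofReal η)
    (hxε : ENNReal.ofReal ε < wasserstein p μ (empiricalMeasure x)) :
    (Measure.pi fun _ : Fin N => μ) (typeClass c K k) ≤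
      ENNReal.ofReal (Real.exp (-(N * (lam / 2) * (ε - η) ^ 2))) := by
  set Q := Measure.pi fun _ : Fin N => μ with hQ
  set A := typeClass c K k with hA
  by_cases h0 : Q A = 0
  · rw [h0]
    exact zero_le
  have hAm : MeasurableSet A := measurableSet_typeClass hc hK k
  have : IsProbabilityMeasure Q[|A] := cond_isProbabilityMeasure h0
  have := isProbabilityMeasure_averageMarginal hN Q[|A]
  have := isProbabilityMeasure_empiricalMeasure hN x
  have hae : ∀ᵐ y ∂Q[|A], y ∈ A := ae_cond_mem hAm
  have hpos : 0 < Q.real A := ENNReal.toReal_pos h0 (measure_ne_top _ _)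
  have hN' : (0 : ℝ) < N := by exact_mod_cast Nat.pos_of_ne_zero hN
  have hlog : 0 ≤ -Real.log (Q.real A) := by
    have := Real.log_nonpos hpos.le measureReal_le_one
    linarith
  have h1 : wasserstein p μ (empiricalMeasure x) ≤
      wasserstein p (averageMarginal Q[|A]) μ + ENNReal.ofReal η :=
    (wasserstein_le_add_of_map_eq hp hc
      (map_averageMarginal_eq_map_empiricalMeasure hc hae hx)
      (ae_averageMarginal_mem hK (hae.mono fun y hy => hy.1)) (ae_empiricalMeasure hK hx.1)
      hwm hw).trans (by gcongr)
  have h2 := h1.trans (add_le_add_left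
    (hT.wasserstein_le hlam (klDiv_averageMarginal_cond_le hN h0)) _)
  rw [← ENNReal.ofReal_add (Real.sqrt_nonneg _) hη] at h2
  have h3 := hxε.trans_le h2
  rw [ENNReal.ofReal_lt_ofReal_iff'] at h3
  have h4 : (ε - η) ^ 2 ≤ 2 / lam * ((N : ℝ)⁻¹ * -Real.log (Q.real A)) := by
    rw [← Real.sq_sqrt (show 0 ≤ 2 / lam * ((N : ℝ)⁻¹ * -Real.log (Q.real A)) by positivity)]
    exact pow_le_pow_left₀ (by linarith) (by linarith [h3.1]) 2
  have h5 : N * (lam / 2) * (ε - η) ^ 2 ≤ -Real.log (Q.real A) := by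
    have := mul_le_mul_of_nonneg_left h4 (show 0 ≤ N * (lam / 2) by positivity)
    have h6 : N * (lam / 2) * (2 / lam * ((N : ℝ)⁻¹ * -Real.log (Q.real A))) =
        -Real.log (Q.real A) := by
      field_simp
    linarith
  rw [← ENNReal.ofReal_toReal (measure_ne_top Q A)]
  refine ENNReal.ofReal_le_ofReal ?_
  calc (Q A).toReal = Real.exp (Real.log (Q.real A)) := (Real.exp_log hpos).symm
    _ ≤ _ := Real.exp_le_exp.2 (by linarith)

/-- A non-asymptotic deviation bound for the empirical measure, in terms of a finite partition of
the space into cells. -/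
theorem measure_wasserstein_empiricalMeasure_gt_le {p lam ε η : ℝ} (hp : 1 ≤ p) (hlam : 0 < lam)
    (hη : 0 ≤ η) (hηε : η ≤ ε) {μ : Measure X} [IsProbabilityMeasure μ]
    (hT : TransportIneq p lam μ) (hN : N ≠ 0) {c : X → ι} (hc : Measurable c) {K : Set X}
    (hK : MeasurableSet K) {w : X → ℝ≥0∞} (hwm : Measurable w)
    (hw : ∀ y ∈ K, ∀ z ∈ K, c y = c z → edist y z ≤ w z) :
    (Measure.pi fun _ : Fin N => μ) {x | (∀ i, x i ∈ K) ∧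
        (∫⁻ z, w z ^ p ∂(empiricalMeasure x)) ^ (1 / p) ≤ ENNReal.ofReal η ∧
        ENNReal.ofReal ε < wasserstein p μ (empiricalMeasure x)} ≤
      ENNReal.ofReal ((N + 1 : ℝ) ^ Fintype.card ι *
        Real.exp (-(N * (lam / 2) * (ε - η) ^ 2))) := by
  classical
  set Q := Measure.pi fun _ : Fin N => μ with hQ
  set B := {x : Fin N → X | (∀ i, x i ∈ K) ∧
    (∫⁻ z, w z ^ p ∂(empiricalMeasure x)) ^ (1 / p) ≤ ENNReal.ofReal η ∧
    ENNReal.ofReal ε < wasserstein p μ (empiricalMeasure x)} with hB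
  -- `B` need not be measurable: covering it by measurable classes is enough.
  have hcover : B ⊆ ⋃ k : ι → Fin (N + 1), typeClass c K k ∩ B := by
    intro x hx
    refine Set.mem_iUnion.2 ⟨fun j => ⟨(Finset.univ.filter fun i => c (x i) = j).card, ?_⟩, ?_, hx⟩
    · have := Finset.card_le_univ (Finset.univ.filter fun i => c (x i) = j)
      rw [Fintype.card_fin] at this
      lia
    · exact ⟨hx.1, fun j => by congr⟩
  have hk : ∀ k : ι → Fin (N + 1), Q (typeClass c K k ∩ B) ≤
      ENNReal.ofReal (Real.exp (-(N * (lam / 2) * (ε - η) ^ 2))) := by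
    intro k
    rcases (typeClass c K k ∩ B).eq_empty_or_nonempty with he | ⟨x, hx, hxB⟩
    · rw [he, measure_empty]
      exact zero_le
    · exact (measure_mono Set.inter_subset_left).trans
        (measure_typeClass_le hp hlam hη hηε hT hN hc hK hwm hw hx hxB.2.1 hxB.2.2)
  calc Q B ≤ ∑ k : ι → Fin (N + 1), Q (typeClass c K k ∩ B) :=
        (measure_mono hcover).trans (measure_iUnion_fintype_le _ _)
    _ ≤ ∑ _k : ι → Fin (N + 1), ENNReal.ofReal (Real.exp (-(N * (lam / 2) * (ε - η) ^ 2))) :=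
        Finset.sum_le_sum fun k _ => hk k
    _ = _ := by
        rw [Finset.sum_const, Finset.card_univ, Fintype.card_fun, Fintype.card_fin, nsmul_eq_mul,
          ENNReal.ofReal_mul (by positivity), ENNReal.ofReal_pow (by positivity)]
        congr 1
        rw [Nat.cast_pow, ENNReal.ofReal_add (by positivity) zero_le_one, ENNReal.ofReal_natCast,
          ENNReal.ofReal_one]
        push_cast
        rfl

end Deviation

/-! ### Numerical estimates for the number of cells. -/

section Numerics

open Filter in
-- For `ε ≤ 1`, `N ≥ ε ^ (-(d' + 2))` gives `N ^ θ ≥ ε ^ (-(d + 2))` with `θ < 1`, and the spare `N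
-- ^ (1 - θ)` beats powers of `log N`. For `ε ≥ 1` the right side is simply `κ Y` with `Y = N ε²`.
lemma exists_forall_log_pow_le {d : ℕ} {d' : ℝ} (hd' : (d : ℝ) < d') {κ : ℝ} (hκ : 0 < κ)
    (C : ℝ) :
    ∃ N₀ : ℝ, 1 ≤ N₀ ∧ ∀ ε : ℝ, 0 < ε → ∀ N : ℝ, N₀ * max (ε ^ (-(d' + 2))) 1 ≤ N →
      (C * (1 + Real.log (N * max 1 (ε ^ 2)))) ^ (d + 1) ≤ κ * (N * ε ^ 2 * min 1 ε ^ d) := by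
  have hd2 : 0 < d' + 2 := by
    have : (0 : ℝ) ≤ d := d.cast_nonneg
    linarith
  set θ := ((d : ℝ) + 2) / (d' + 2) with hθ
  have hθ0 : 0 < θ := by positivity
  have hθ1 : θ < 1 := by
    rw [hθ, div_lt_one hd2]
    linarith
  set r := (1 - θ) / (d + 1) with hr
  have hr0 : 0 < r := div_pos (by linarith) (by positivity)
  set κ' := κ ^ ((d + 1 : ℝ)⁻¹) with hκ'
  have hκ'0 : 0 < κ' := Real.rpow_pos_of_pos hκ _
  have h1 : (fun Y : ℝ => C * (1 + Real.log Y)) =o[atTop] fun Y : ℝ => Y ^ r := by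
    refine Asymptotics.IsLittleO.const_mul_left ?_ C
    refine Asymptotics.IsLittleO.add ?_ (isLittleO_log_rpow_atTop hr0)
    rw [Asymptotics.isLittleO_const_left]
    right
    exact tendsto_norm_atTop_atTop.comp (tendsto_rpow_atTop hr0)
  obtain ⟨Y₀, hY₀⟩ := eventually_atTop.1 (h1.bound hκ'0)
  refine ⟨max Y₀ 1, le_max_right _ _, fun ε hε N hN => ?_⟩
  have hN1 : max Y₀ 1 ≤ N := by
    refine le_trans (le_mul_of_one_le_right (by positivity) (le_max_right _ _)) hN
  have hNε : ε ^ (-(d' + 2)) ≤ N := by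
    refine le_trans (le_trans (le_max_left _ 1) ?_) hN
    exact le_mul_of_one_le_left (by positivity) (le_max_right _ _)
  have hN0 : 0 < N := by linarith [le_max_right Y₀ 1]
  set Y := N * max 1 (ε ^ 2) with hY
  have hNY : N ≤ Y := le_mul_of_one_le_right hN0.le (le_max_left _ _)
  have hY1 : 1 ≤ Y := (le_max_right _ _).trans (hN1.trans hNY)
  have hY0 : 0 < Y := by linarith
  have h2 := hY₀ Y ((le_max_left _ _).trans (hN1.trans hNY))
  rw [Real.norm_eq_abs, Real.norm_of_nonneg (by positivity)] at h2
  have h3 : (C * (1 + Real.log Y)) ^ (d + 1) ≤ κ * Y ^ (1 - θ) := by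
    calc (C * (1 + Real.log Y)) ^ (d + 1) ≤ |C * (1 + Real.log Y)| ^ (d + 1) := by
          rw [← abs_pow]
          exact le_abs_self _
      _ ≤ (κ' * Y ^ r) ^ (d + 1) := by gcongr
      _ = κ * Y ^ (1 - θ) := by
          rw [mul_pow, hκ', ← Real.rpow_natCast, ← Real.rpow_natCast, ← Real.rpow_mul hκ.le,
            ← Real.rpow_mul hY0.le, hr]
          push_cast
          rw [inv_mul_cancel₀ (by positivity), div_mul_cancel₀ _ (by positivity), Real.rpow_one]
  refine h3.trans (mul_le_mul_of_nonneg_left ?_ hκ.le)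
  rcases le_total 1 ε with h | h
  · have hmax : max 1 (ε ^ 2) = ε ^ 2 := max_eq_right (one_le_pow₀ h)
    rw [min_eq_left h, one_pow, mul_one, ← hmax, ← hY]
    calc Y ^ (1 - θ) ≤ Y ^ (1 : ℝ) := Real.rpow_le_rpow_of_exponent_le hY1 (by linarith)
      _ = Y := Real.rpow_one Y
  · have hmax : max 1 (ε ^ 2) = 1 := max_eq_left (pow_le_one₀ hε.le h)
    have hYN : Y = N := by rw [hY, hmax, mul_one]
    rw [min_eq_right h, hYN, mul_assoc, ← pow_add, Real.rpow_sub hN0, Real.rpow_one,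
      div_le_iff₀ (by positivity), mul_assoc]
    refine le_mul_of_one_le_right hN0.le ?_
    have h4 : ε ^ (-((d : ℝ) + 2)) ≤ N ^ θ := by
      calc ε ^ (-((d : ℝ) + 2)) = (ε ^ (-(d' + 2))) ^ θ := by
            rw [← Real.rpow_mul hε.le, hθ]
            congr 1
            field_simp
        _ ≤ N ^ θ := by gcongr
    calc (1 : ℝ) = ε ^ (2 + d) * ε ^ (-((d : ℝ) + 2)) := by
          rw [← Real.rpow_natCast, ← Real.rpow_add hε]
          push_cast
          rw [show (2 + (d : ℝ)) + -((d : ℝ) + 2) = 0 by ring, Real.rpow_zero]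
      _ ≤ _ := by gcongr

lemma Real.arsinh_le_log_one_add {x : ℝ} (hx : 0 ≤ x) : Real.arsinh x ≤ Real.log (1 + 2 * x) := by
  have : √(1 + x ^ 2) ≤ 1 + x := by
    rw [Real.sqrt_le_left (by positivity)]
    nlinarith
  rw [Real.arsinh]
  exact Real.log_le_log (by positivity) (by linarith)

/-- The number of cells needed to resolve a ball of radius `√(B Y)`. -/
lemma exists_nat_arsinh_le {B c s Y : ℝ} (hB : 0 < B) (hc : 0 < c) (hs0 : 0 < s) (hs1 : s ≤ 1)
    (hY : 1 ≤ Y) : ∃ L : ℕ, Real.arsinh (√(B * Y)) ≤ c * s * L ∧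
      (2 * L + 1 : ℝ) ≤ (2 * (1 + 2 * √B) / c + 3) * (1 + Real.log Y) / s := by
  have hlogY : 0 ≤ Real.log Y := Real.log_nonneg hY
  have hsY : 1 ≤ √Y := Real.one_le_sqrt.2 hY
  set C := 1 + 2 * √B with hC
  have hC1 : 1 ≤ C := by
    have := Real.sqrt_nonneg B
    linarith
  have h1 : Real.arsinh (√(B * Y)) ≤ C * (1 + Real.log Y) := by
    calc Real.arsinh (√(B * Y)) ≤ Real.log (1 + 2 * √(B * Y)) :=
          Real.arsinh_le_log_one_add (Real.sqrt_nonneg _)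
      _ ≤ Real.log (C * √Y) := by
          refine Real.log_le_log (by positivity) ?_
          rw [Real.sqrt_mul hB.le, hC]
          linarith
      _ = Real.log C + Real.log Y / 2 := by
          rw [Real.log_mul (by positivity) (by positivity), Real.log_sqrt (by linarith)]
      _ ≤ C * (1 + Real.log Y) := by
          have := Real.log_le_sub_one_of_pos (show 0 < C by linarith)
          nlinarith
  refine ⟨⌈Real.arsinh (√(B * Y)) / (c * s)⌉₊, ?_, ?_⟩
  · rw [mul_comm (c * s), ← div_le_iff₀ (by positivity)]
    exact Nat.le_ceil _
  · have h2 := (Nat.ceil_lt_add_one (show 0 ≤ Real.arsinh (√(B * Y)) / (c * s) from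
      div_nonneg (Real.arsinh_nonneg_iff.2 (Real.sqrt_nonneg _)) (by positivity))).le
    have h3 : Real.arsinh (√(B * Y)) / (c * s) ≤ C * (1 + Real.log Y) / (c * s) := by gcongr
    -- The `3` pays for rounding up, counted twice, and for the `1` in `2 * L + 1`.
    have h4 : 3 ≤ 3 * (1 + Real.log Y) / s := by
      rw [le_div_iff₀ hs0]
      nlinarith
    have h5 : (2 * C / c + 3) * (1 + Real.log Y) / s =
        2 * (C * (1 + Real.log Y) / (c * s)) + 3 * (1 + Real.log Y) / s := by
      field_simp
    rw [h5]
    linarith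

end Numerics

/-! ### Chernoff bound for the sum of squared norms. -/

section MomentTail

variable {E : Type*} [NormedAddCommGroup E] [MeasurableSpace E] [OpensMeasurableSpace E] {N : ℕ}

lemma measure_pi_sum_sq_gt_le {α : ℝ} (hα : 0 ≤ α) {μ : Measure E} [IsProbabilityMeasure μ]
    (T : ℝ) :
    (Measure.pi fun _ : Fin N => μ) {x | T < ∑ i, ‖x i‖ ^ 2} ≤
      ENNReal.ofReal (Real.exp (-(α * T))) * sqExpMoment α μ ^ N := by
  set Q := Measure.pi fun _ : Fin N => μ with hQ
  set g : E → ℝ≥0∞ := fun x => ENNReal.ofReal (Real.exp (α * ‖x‖ ^ 2)) with hg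
  have hgm : Measurable g := by fun_prop
  have hm : MeasurableSet {x : Fin N → E | T < ∑ i, ‖x i‖ ^ 2} :=
    measurableSet_lt measurable_const (by fun_prop)
  have hind : iIndepFun (fun (i : Fin N) (x : Fin N → E) => g (x i)) Q :=
    iIndepFun_pi (fun _ => hgm.aemeasurable)
  have hprod : ∫⁻ x, ∏ i, g (x i) ∂Q = sqExpMoment α μ ^ N := by
    rw [lintegral_prod_eq_prod_lintegral_of_indepFun Finset.univ _ hind fun i =>
      hgm.comp (measurable_pi_apply i)]
    have : ∀ i : Fin N, ∫⁻ x, g (x i) ∂Q = sqExpMoment α μ := fun i => by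
      rw [sqExpMoment, ← (measurePreserving_eval (fun _ : Fin N => μ) i).lintegral_comp hgm]
    simp [this]
  calc Q {x | T < ∑ i, ‖x i‖ ^ 2}
      = ∫⁻ x, {x : Fin N → E | T < ∑ i, ‖x i‖ ^ 2}.indicator 1 x ∂Q :=
        (lintegral_indicator_one hm).symm
    _ ≤ ∫⁻ x, ENNReal.ofReal (Real.exp (-(α * T))) * ∏ i, g (x i) ∂Q := by
        refine lintegral_mono fun x => ?_
        refine Set.indicator_apply_le' (fun hx => ?_) fun _ => zero_le
        rw [hg, ← ENNReal.ofReal_prod_of_nonneg fun i _ => (Real.exp_pos _).le, ← Real.exp_sum,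
          ← ENNReal.ofReal_mul (Real.exp_pos _).le, ← Real.exp_add, ← Finset.mul_sum,
          Pi.one_apply, ENNReal.one_le_ofReal, Real.one_le_exp_iff]
        have := mul_le_mul_of_nonneg_left (le_of_lt hx) hα
        linarith
    _ = _ := by rw [lintegral_const_mul _ (by fun_prop), hprod]

end MomentTail

/-! ### Choice of parameters and conclusion. -/

section Main

lemma min_one_sq_mul_max_one_sq {ε : ℝ} (hε : 0 < ε) :
    min 1 ε ^ 2 * max 1 (ε ^ 2) = ε ^ 2 := by
  rcases le_total 1 ε with h | h
  · rw [min_eq_left h, max_eq_right (one_le_pow₀ h), one_pow, one_mul]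
  · rw [min_eq_right h, max_eq_left (pow_le_one₀ hε.le h), mul_one]

/-- The left side is the logarithm of the number of type classes, plus a `log 2` reserved for
splitting the error into two halves. -/
lemma cells_mul_log_le {d L : ℕ} {C N s M₁ : ℝ} (hC : 1 ≤ C) (hN : 1 ≤ N) (hs0 : 0 < s)
    (hM : 1 ≤ M₁) (hL : (2 * L + 1 : ℝ) ≤ C * (1 + Real.log (N * M₁)) / s) :
    ((2 * L + 1) ^ d : ℕ) * Real.log (N + 1) + Real.log 2 ≤
      (2 * C * (1 + Real.log (N * M₁))) ^ (d + 1) / s ^ d := by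
  set ℓ := Real.log (N * M₁) with hℓ
  have hNM : N ≤ N * M₁ := le_mul_of_one_le_right (by linarith) hM
  have hℓ0 : 0 ≤ ℓ := Real.log_nonneg (hN.trans hNM)
  have hlog2 : Real.log 2 ≤ 1 := by
    have := Real.log_le_sub_one_of_pos (show (0 : ℝ) < 2 by norm_num)
    linarith
  have h1 : Real.log (N + 1) ≤ 1 + ℓ := by
    calc Real.log (N + 1) ≤ Real.log (2 * (N * M₁)) :=
          Real.log_le_log (by linarith) (by linarith)
      _ = Real.log 2 + ℓ := Real.log_mul (by norm_num) (by linarith)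
      _ ≤ 1 + ℓ := by linarith
  set a := C * (1 + ℓ) / s with ha
  have ha1 : 1 ≤ a := by
    have : (0 : ℝ) ≤ L := L.cast_nonneg
    linarith
  have had : 1 ≤ a ^ d := one_le_pow₀ ha1
  have h2 : (((2 * L + 1) ^ d : ℕ) : ℝ) ≤ a ^ d := by
    push_cast
    gcongr
  have hCℓ : 1 + ℓ ≤ C * (1 + ℓ) := le_mul_of_one_le_left (by linarith) hC
  calc (((2 * L + 1) ^ d : ℕ) : ℝ) * Real.log (N + 1) + Real.log 2
      ≤ a ^ d * (1 + ℓ) + a ^ d * (1 + ℓ) := by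
        refine add_le_add (mul_le_mul h2 h1 (Real.log_nonneg (by linarith)) (by linarith)) ?_
        nlinarith
    _ = a ^ d * (2 * (1 + ℓ)) := by ring
    _ ≤ (2 * C * (1 + ℓ) / s) ^ d * (2 * C * (1 + ℓ)) := by
        have : a ≤ 2 * C * (1 + ℓ) / s := by
          rw [ha]
          gcongr
          linarith
        gcongr ?_ ^ d * ?_
        linarith
    _ = _ := by
        rw [div_pow, pow_succ]
        ring

variable {d : ℕ}

/-- Here `p ≤ 2` enters: the mean square norm of the sample controls the quadratic mean of the cell
sizes, hence the mean of order `p`. -/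
lemma lintegral_rpow_empiricalMeasure_le {p : ℝ} (hp1 : 1 ≤ p) (hp2 : p ≤ 2) {N : ℕ}
    (hN : N ≠ 0) {h D S η : ℝ} (hh : 0 ≤ h) (hD : 0 ≤ D) (hη : 0 ≤ η)
    {x : Fin N → EuclideanSpace ℝ (Fin d)} (hx : ∑ i, ‖x i‖ ^ 2 ≤ N * S)
    (hS : 4 * h ^ 2 * (D + S) ≤ η ^ 2) :
    (∫⁻ z, ENNReal.ofReal (2 * h * √(D + ‖z‖ ^ 2)) ^ p ∂(empiricalMeasure x)) ^ (1 / p) ≤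
      ENNReal.ofReal η := by
  have := isProbabilityMeasure_empiricalMeasure hN x
  have hN' : (0 : ℝ) < N := by exact_mod_cast Nat.pos_of_ne_zero hN
  refine (lintegral_rpow_le_of_le_two hp1 hp2 (by fun_prop)).trans ?_
  rw [lintegral_empiricalMeasure x (by fun_prop)]
  have h1 : ∀ i, ENNReal.ofReal (2 * h * √(D + ‖x i‖ ^ 2)) ^ 2 =
      ENNReal.ofReal (4 * h ^ 2 * (D + ‖x i‖ ^ 2)) := fun i => by
    rw [← ENNReal.ofReal_pow (by positivity), mul_pow, Real.sq_sqrt (by positivity)]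
    ring_nf
  have h2 : (N : ℝ≥0∞)⁻¹ = ENNReal.ofReal (N : ℝ)⁻¹ := by
    rw [ENNReal.ofReal_inv_of_pos hN', ENNReal.ofReal_natCast]
  simp only [h1]
  rw [← ENNReal.ofReal_sum_of_nonneg fun i _ => by positivity, h2,
    ← ENNReal.ofReal_mul (by positivity)]
  calc ENNReal.ofReal ((N : ℝ)⁻¹ * ∑ i, 4 * h ^ 2 * (D + ‖x i‖ ^ 2)) ^ (1 / 2 : ℝ)
      ≤ ENNReal.ofReal (η ^ 2) ^ (1 / 2 : ℝ) := by
        gcongr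
        refine le_trans ?_ hS
        rw [← Finset.mul_sum, Finset.sum_add_distrib, Finset.sum_const, Finset.card_univ,
          Fintype.card_fin, nsmul_eq_mul, inv_mul_le_iff₀ hN']
        calc 4 * h ^ 2 * (N * D + ∑ i, ‖x i‖ ^ 2) ≤ 4 * h ^ 2 * (N * D + N * S) := by gcongr
          _ = _ := by ring
    _ = ENNReal.ofReal η := by
        rw [ENNReal.ofReal_rpow_of_nonneg (by positivity) (by norm_num), ← Real.sqrt_eq_rpow,
          Real.sqrt_sq hη]

lemma measure_pi_wasserstein_gt_le {p : ℝ} (hp1 : 1 ≤ p) (hp2 : p ≤ 2) {lam : ℝ}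
    (hlam : 0 < lam) {α : ℝ} (hα : 0 ≤ α)
    {μ : Measure (EuclideanSpace ℝ (Fin d))} [IsProbabilityMeasure μ] (hT : TransportIneq p lam μ)
    {N : ℕ} (hN : N ≠ 0) {ε η h S : ℝ} (hη : 0 ≤ η) (hηε : η ≤ ε) (hh0 : 0 < h) (hh1 : h ≤ 1)
    (hS : 4 * h ^ 2 * (d + S) ≤ η ^ 2) {L : ℕ} (hL : Real.arsinh (√(N * S)) ≤ h * L) :
    (Measure.pi fun _ : Fin N => μ)
        {x | ENNReal.ofReal ε < wasserstein p μ (empiricalMeasure x)} ≤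
      ENNReal.ofReal (Real.exp (-(α * (N * S)))) * sqExpMoment α μ ^ N +
      ENNReal.ofReal ((N + 1 : ℝ) ^ ((2 * L + 1) ^ d) *
        Real.exp (-(N * (lam / 2) * (ε - η) ^ 2))) := by
  set K : Set (EuclideanSpace ℝ (Fin d)) := Metric.closedBall 0 (√(N * S)) with hK
  set w : EuclideanSpace ℝ (Fin d) → ℝ≥0∞ := fun z =>
    ENNReal.ofReal (2 * h * √(d + ‖z‖ ^ 2)) with hw
  have hcell : ∀ y ∈ K, ∀ z ∈ K, arsinhCell h L y = arsinhCell h L z → edist y z ≤ w z := by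
    intro y hy z hz hyz
    have h1 := norm_sub_sq_le_of_arsinhCell_eq hh0 hh1 hL (mem_closedBall_zero_iff.1 hy)
      (mem_closedBall_zero_iff.1 hz) hyz
    rw [edist_dist, dist_eq_norm]
    refine ENNReal.ofReal_le_ofReal (abs_le_of_sq_le_sq' ?_ (by positivity)).2
    rw [mul_pow, Real.sq_sqrt (by positivity)]
    linarith
  have hsub : {x : Fin N → EuclideanSpace ℝ (Fin d) |
      ENNReal.ofReal ε < wasserstein p μ (empiricalMeasure x)} ⊆
      {x | N * S < ∑ i, ‖x i‖ ^ 2} ∪ {x | (∀ i, x i ∈ K) ∧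
        (∫⁻ z, w z ^ p ∂(empiricalMeasure x)) ^ (1 / p) ≤ ENNReal.ofReal η ∧
        ENNReal.ofReal ε < wasserstein p μ (empiricalMeasure x)} := by
    intro x hx
    rcases lt_or_ge (N * S) (∑ i, ‖x i‖ ^ 2) with hlt | hge
    · exact Or.inl hlt
    · refine Or.inr ⟨fun i => ?_, ?_, hx⟩
      · refine mem_closedBall_zero_iff.2 (Real.le_sqrt_of_sq_le (le_trans ?_ hge))
        exact Finset.single_le_sum (f := fun i => ‖x i‖ ^ 2) (fun j _ => by positivity)
          (Finset.mem_univ i)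
      · exact lintegral_rpow_empiricalMeasure_le hp1 hp2 hN hh0.le d.cast_nonneg hη hge hS
  refine (measure_mono hsub).trans ((measure_union_le _ _).trans ?_)
  refine add_le_add (measure_pi_sum_sq_gt_le hα _) ?_
  have := measure_wasserstein_empiricalMeasure_gt_le (N := N) hp1 hlam hη hηε hT hN
    (measurable_arsinhCell h L) (K := K) Metric.isClosed_closedBall.measurableSet (w := w)
    (by fun_prop) hcell
  rwa [card_arsinhCell] at this

/-- The deviation bound for the product measure, with an explicit choice of the threshold. -/
lemma exists_forall_measure_pi_wasserstein_gt_le {p : ℝ} (hp1 : 1 ≤ p) (hp2 : p ≤ 2) {lam : ℝ}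
    (hlam : 0 < lam) {d' : ℝ} (hd' : (d : ℝ) < d') {lam' : ℝ} (hlam'0 : 0 < lam')
    (hlam' : lam' < lam) {α : ℝ} (hα0 : 0 < α) (hα : α < lam / 2) (m : ℝ) :
    ∃ N₀ : ℝ, 0 < N₀ ∧ ∀ (μ : Measure (EuclideanSpace ℝ (Fin d))) [IsProbabilityMeasure μ],
      TransportIneq p lam μ → (sqExpMoment α μ).toReal ≤ m → ∀ ε : ℝ, 0 < ε → ∀ N : ℕ,
      N₀ * max (ε ^ (-(d' + 2))) 1 ≤ (N : ℝ) →
        (Measure.pi fun _ : Fin N => μ)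
            {x | ENNReal.ofReal ε < wasserstein p μ (empiricalMeasure x)} ≤
          ENNReal.ofReal (Real.exp (-(lam' / 2 * N * ε ^ 2))) := by
  set m₁ := max m 1 with hm₁
  have hm₁1 : 1 ≤ m₁ := le_max_right _ _
  have hlogm : 0 ≤ Real.log m₁ := Real.log_nonneg hm₁1
  -- In `α * B`, `log m₁` cancels the moment factor, `lam / 2` gives the required decay and `1` pays
  -- for the `log 2`.
  set B := (Real.log m₁ + lam / 2 + 1) / α with hB
  have hB1 : 1 ≤ B := by
    rw [hB, one_le_div hα0]
    linarith
  have hB0 : 0 < B := by linarith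
  have hαB : α * B = Real.log m₁ + lam / 2 + 1 := mul_div_cancel₀ _ hα0.ne'
  -- With `η = δ * ε` the rate drops from `lam` only to the midpoint of `lam'` and `lam`; the
  -- remaining half of the gap, `κ` below, pays for the count of classes.
  set δ := 1 - √((lam + lam') / 2 / lam) with hδ
  have hδ1 : δ ≤ 1 := by
    have := Real.sqrt_nonneg ((lam + lam') / 2 / lam)
    linarith
  have hδ0 : 0 < δ := by
    have : √((lam + lam') / 2 / lam) < 1 := by
      rw [Real.sqrt_lt' one_pos, one_pow, div_lt_one hlam]
      linarith
    linarith
  have hδlam : lam * (1 - δ) ^ 2 = (lam + lam') / 2 := by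
    rw [hδ, sub_sub_cancel, Real.sq_sqrt (by positivity), mul_div_cancel₀ _ hlam.ne']
  set κ := (lam - lam') / 4 with hκ
  have hκ0 : 0 < κ := by
    rw [hκ]
    linarith
  set c := δ / (2 * √(d + B)) with hc
  have hdB : 1 ≤ √(d + B) := Real.one_le_sqrt.2 (by linarith [(d.cast_nonneg : (0 : ℝ) ≤ d)])
  have hc0 : 0 < c := by positivity
  have hc1 : c ≤ 1 := by
    rw [hc, div_le_one (by positivity)]
    linarith
  have hcB : 4 * c ^ 2 * (d + B) = δ ^ 2 := by
    rw [hc, div_pow, mul_pow, Real.sq_sqrt (by positivity)]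
    field_simp
    norm_num
  set C := 2 * (1 + 2 * √B) / c + 3 with hC
  have hC1 : 1 ≤ C := by
    have : 0 ≤ 2 * (1 + 2 * √B) / c := by positivity
    linarith
  obtain ⟨N₀, hN₀1, hN₀⟩ := exists_forall_log_pow_le hd' hκ0 (2 * C)
  refine ⟨N₀, by linarith, fun μ _ hT hμm ε hε N hN => ?_⟩
  have hN1 : (1 : ℝ) ≤ N := by
    refine hN₀1.trans (le_trans ?_ hN)
    exact le_mul_of_one_le_right (by linarith) (le_max_right _ _)
  have hN0 : N ≠ 0 := by
    rintro rfl
    norm_num at hN1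
  have hkey := hN₀ ε hε N hN
  -- Taking `h = c * s` and `S = B * M₁`, the identity `s² M₁ = ε²` treats small and large `ε` at
  -- once.
  set s := min 1 ε with hs
  have hs0 : 0 < s := lt_min one_pos hε
  have hs1 : s ≤ 1 := min_le_left _ _
  set M₁ := max 1 (ε ^ 2) with hM₁
  have hM₁1 : 1 ≤ M₁ := le_max_left _ _
  have hM₁ε : ε ^ 2 ≤ M₁ := le_max_right _ _
  have hsM : s ^ 2 * M₁ = ε ^ 2 := min_one_sq_mul_max_one_sq hε
  have hY1 : 1 ≤ N * M₁ := one_le_mul_of_one_le_of_one_le hN1 hM₁1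
  obtain ⟨L, hL1, hL2⟩ := exists_nat_arsinh_le hB0 hc0 hs0 hs1 hY1
  have hL1' : Real.arsinh (√(N * (B * M₁))) ≤ c * s * L := by
    rwa [show (N : ℝ) * (B * M₁) = B * (N * M₁) by ring]
  have hS : 4 * (c * s) ^ 2 * (d + B * M₁) ≤ (δ * ε) ^ 2 := by
    calc 4 * (c * s) ^ 2 * (d + B * M₁) ≤ 4 * (c * s) ^ 2 * ((d + B) * M₁) := by
          gcongr
          rw [add_mul]
          gcongr
          exact le_mul_of_one_le_right d.cast_nonneg hM₁1
      _ = 4 * c ^ 2 * (d + B) * (s ^ 2 * M₁) := by ring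
      _ = (δ * ε) ^ 2 := by rw [hcB, hsM, mul_pow]
  have hmain := measure_pi_wasserstein_gt_le hp1 hp2 hlam hα0.le hT hN0 (ε := ε) (η := δ * ε)
    (h := c * s) (S := B * M₁) (by positivity) (mul_le_of_le_one_left hε.le hδ1) (by positivity)
    (mul_le_one₀ hc1 hs0.le hs1) hS hL1'
  refine hmain.trans ?_
  set G := lam' / 2 * N * ε ^ 2 with hG
  have hlog2 : Real.log 2 ≤ 1 := by
    have := Real.log_le_sub_one_of_pos (show (0 : ℝ) < 2 by norm_num)
    linarith
  have hhalf : Real.exp (-G - Real.log 2) = Real.exp (-G) / 2 := by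
    rw [Real.exp_sub, Real.exp_log two_pos]
  have hfirst : ENNReal.ofReal (Real.exp (-(α * (N * (B * M₁))))) * sqExpMoment α μ ^ N ≤
      ENNReal.ofReal (Real.exp (-G) / 2) := by
    have hmom : sqExpMoment α μ ≤ ENNReal.ofReal (Real.exp (Real.log m₁)) := by
      rw [Real.exp_log (by linarith)]
      exact (ENNReal.le_ofReal_iff_toReal_le (hT.sqExpMoment_lt_top hp1 hα0 hα).ne
        (by linarith)).2 (hμm.trans (le_max_left _ _))
    calc _ ≤ ENNReal.ofReal (Real.exp (-(α * (N * (B * M₁))))) *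
          ENNReal.ofReal (Real.exp (Real.log m₁)) ^ N := by gcongr
      _ = ENNReal.ofReal (Real.exp (-(α * (N * (B * M₁))) + N * Real.log m₁)) := by
          rw [← ENNReal.ofReal_pow (Real.exp_pos _).le, ← Real.exp_nat_mul,
            ← ENNReal.ofReal_mul (Real.exp_pos _).le, ← Real.exp_add]
      _ ≤ _ := by
          rw [← hhalf]
          refine ENNReal.ofReal_le_ofReal (Real.exp_le_exp.2 ?_)
          have h1 : Real.log m₁ + lam' / 2 * ε ^ 2 + 1 ≤ α * B * M₁ := by
            have ha : Real.log m₁ ≤ Real.log m₁ * M₁ := le_mul_of_one_le_right hlogm hM₁1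
            have hb : lam' / 2 * ε ^ 2 ≤ lam / 2 * M₁ := by gcongr
            rw [hαB, add_mul, add_mul]
            linarith
          have h2 := mul_le_mul_of_nonneg_left h1 (zero_le_one.trans hN1)
          rw [hG]
          linarith
  have hsecond : ENNReal.ofReal ((N + 1 : ℝ) ^ ((2 * L + 1) ^ d) *
      Real.exp (-(N * (lam / 2) * (ε - δ * ε) ^ 2))) ≤ ENNReal.ofReal (Real.exp (-G) / 2) := by
    have h1 := (cells_mul_log_le (d := d) hC1 hN1 hs0 hM₁1 hL2).trans
      (div_le_of_le_mul₀ (by positivity) (by positivity)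
        (hkey.trans_eq (mul_assoc κ (N * ε ^ 2) (s ^ d)).symm))
    have h2 : (N + 1 : ℝ) ^ ((2 * L + 1) ^ d) =
        Real.exp (((2 * L + 1) ^ d : ℕ) * Real.log (N + 1)) := by
      rw [Real.exp_nat_mul, Real.exp_log (by positivity)]
    rw [h2, ← Real.exp_add, ← hhalf]
    refine ENNReal.ofReal_le_ofReal (Real.exp_le_exp.2 ?_)
    have h3 : N * (lam / 2) * (ε - δ * ε) ^ 2 = G + κ * (N * ε ^ 2) := by
      calc N * (lam / 2) * (ε - δ * ε) ^ 2 = N / 2 * ε ^ 2 * (lam * (1 - δ) ^ 2) := by ring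
        _ = _ := by
          rw [hδlam, hG, hκ]
          ring
    rw [h3]
    linarith
  refine (add_le_add hfirst hsecond).trans_eq ?_
  rw [← ENNReal.ofReal_add (by positivity) (by positivity), add_halves]

lemma gammaConst_le_one (p : ℝ) : gammaConst p ≤ 1 := by
  have : 1 ≤ √2 := Real.one_le_sqrt.2 one_le_two
  rw [gammaConst]
  split_ifs
  · exact le_rfl
  · linarith

lemma gammaConst_nonneg (p : ℝ) : 0 ≤ gammaConst p := by
  have : √2 ≤ 3 / 2 := by
    rw [Real.sqrt_le_left (by norm_num)]
    norm_num
  rw [gammaConst]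
  split_ifs
  · exact zero_le_one
  · linarith

end Main

theorem mainTheorem1 (d : ℕ) (p : ℝ) (hp1 : 1 ≤ p) (hp2 : p ≤ 2)
    (lam : ℝ) (hlam : 0 < lam) (d' : ℝ) (hd' : (d : ℝ) < d') (lam' : ℝ) (hlam' : lam' < lam)
    (α : ℝ) (hα0 : 0 < α) (hα : α < lam / 2) :
    ∃ N₀ : ℝ → ℝ, (∀ m : ℝ, 0 < N₀ m) ∧
      ∀ (μ : Measure (EuclideanSpace ℝ (Fin d))) [IsProbabilityMeasure μ],
        TransportIneq p lam μ →
          sqExpMoment α μ < ∞ ∧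
          ∀ (ε : ℝ), 0 < ε →
          ∀ (N : ℕ), N₀ (sqExpMoment α μ).toReal * max (ε ^ (-(d' + 2))) 1 ≤ (N : ℝ) →
          ∀ (Ω : Type*) [MeasurableSpace Ω] (P : Measure Ω) [IsProbabilityMeasure P]
            (X : Fin N → Ω → EuclideanSpace ℝ (Fin d)),
            (∀ i, HasLaw (X i) μ P) → iIndepFun X P →
              P {ω | ENNReal.ofReal ε < wasserstein p μ (empiricalMeasure fun i => X i ω)} ≤
                ENNReal.ofReal (Real.exp (-(gammaConst p * (lam' / 2) * (N : ℝ) * ε ^ 2))) := by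
  -- For `lam' ≤ 0` the right side is at least `1`.
  rcases le_or_gt lam' 0 with h0 | h0
  · refine ⟨fun _ => 1, fun _ => one_pos, fun μ _ hT => ⟨hT.sqExpMoment_lt_top hp1 hα0 hα, ?_⟩⟩
    intro ε hε N hN Ω _ P _ X hX hXi
    refine prob_le_one.trans ?_
    rw [ENNReal.one_le_ofReal, Real.one_le_exp_iff, neg_nonneg]
    exact mul_nonpos_of_nonpos_of_nonneg (mul_nonpos_of_nonpos_of_nonneg
      (mul_nonpos_of_nonneg_of_nonpos (gammaConst_nonneg p) (by linarith)) N.cast_nonneg)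
      (sq_nonneg ε)
  · choose N₀ hN₀0 hN₀ using fun m =>
      exists_forall_measure_pi_wasserstein_gt_le hp1 hp2 hlam hd' h0 hlam' hα0 hα m
    refine ⟨N₀, hN₀0, fun μ _ hT => ⟨hT.sqExpMoment_lt_top hp1 hα0 hα, ?_⟩⟩
    intro ε hε N hN Ω _ P _ X hX hXi
    have hlaw := hXi.hasLaw_pi hX
    calc P {ω | ENNReal.ofReal ε < wasserstein p μ (empiricalMeasure fun i => X i ω)}
        ≤ (P.map fun ω i => X i ω)
            {x | ENNReal.ofReal ε < wasserstein p μ (empiricalMeasure x)} :=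
          -- This inequality holds without measurability of the deviation event.
          Measure.le_map_apply hlaw.aemeasurable _
      _ = (Measure.pi fun _ : Fin N => μ)
            {x | ENNReal.ofReal ε < wasserstein p μ (empiricalMeasure x)} := by rw [hlaw.map_eq]
      _ ≤ ENNReal.ofReal (Real.exp (-(lam' / 2 * N * ε ^ 2))) :=
          hN₀ _ μ hT le_rfl ε hε N hN
      _ ≤ _ := by
          refine ENNReal.ofReal_le_ofReal (Real.exp_le_exp.2 (neg_le_neg ?_))
          gcongr
          -- The bound has been obtained with constant `1` for every `p`, including `p = 2`; the
          -- factor `gammaConst p ≤ 1` only weakens it.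
          exact mul_le_of_le_one_left (by positivity) (gammaConst_le_one p)
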